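/- Let $K$ be a field; operads are symmetric operads in $K$-vector spaces. For an $S_2$-module $E$ of finite dimension let $F(E)$ be the free operad on $E$ (placed in arity $2$), and for a sub-$S_3$-module $R\subseteq F(E)(3)$ let $P(E,R)=F(E)/(R)$ be the corresponding quadratic operad, where $(R)$ is the operadic ideal generated by $R$. Put $E^\vee=E^*\otimes\mathrm{sgn}$, that is, $(\sigma\cdot f)(x)=\mathrm{sgn}(\sigma)f(\sigma^{-1}\cdot x)$. The space $F(E)(3)$ is the direct sum of three copies of $E\otimes E$, in which $\mu\otimes\nu$ stands for $\mu(\nu(x_i,x_j),x_k)$ with $(i,j,k)\in\{(1,2,3),(2,3,1),(3,1,2)\}$, and likewise for $E^\vee$. Let $R^\perp\subseteq F(E^\vee)(3)$ be the orthogonal of $R$ for the pairing $\langle\alpha\otimes\beta,\mu\otimes\nu\rangle=\alpha(\mu)\beta(\nu)$ on copies of the same index, and $0$ on copies of different indices. The Koszul dual of $P=P(E,R)$ is the quadratic operad $P^!=P(E^\vee,R^\perp)$. Let $\mathcal P_\searrow$ be the operad generated by two binary operations $m$ and $\searrow$ (that is, $E$ is the free $S_2$-module with basis $m,\searrow$),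 with relations $$\searrow\circ(m,I)=\searrow\circ(I,\searrow),\qquad \searrow\circ(I,m)=m\circ(\searrow,I),\qquad m\circ(m,I)=m\circ(I,m),$$ where $p\circ(q,I)$ is the operation $p(q(x_1,x_2),x_3)$ and $p\circ(I,q)$ is the operation $p(x_1,q(x_2,x_3))$. In $\mathcal P_\searrow^!(2)$ denote again by $m$ and $\searrow$ the classes of the elements $m^*$ and $\searrow^*$ of the basis of $E^\vee$ dual to the basis $\{\sigma\cdot m,\ \sigma\cdot{\searrow}\mid\sigma\in S_2\}$ of $E$. **Theorem.** The operad $\mathcal P_\searrow^!$ is generated by $m$ and $\searrow\in\mathcal P_\searrow^!(2)$ with the relations $$\begin{array}{rcl} \searrow\circ(m,I)&=&\searrow\circ(I,\searrow),\\ m\circ(m,I)&=&m\circ(I,m),\\ m\circ(\searrow,I)&=&\searrow\circ(I,m),\\ \searrow\circ(\searrow,I)&=&0,\\ m\circ(I,\searrow)&=&0; \end{array}$$ that is, the operad presented by two binary generators and these relations is isomorphic to $\mathcal P_\searrow^!$ by an isomorphism which sends the generators to $m$ and $\searrow$. In particular $\mathcal P_\searrow^!$ is a quotient of $\mathcal P_\searrow$: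 there is a surjective morphism of operads $\mathcal P_\searrow\to\mathcal P_\searrow^!$ which sends $m$ to $m$ and $\searrow$ to $\searrow$. -/

import Mathlib

noncomputable section

open scoped TensorProduct

namespace SymOperad

universe u v w

/-! ## Symmetric operads in vector spaces

Operads are encoded by finite sets of inputs: `obj A` is the space of operations whose inputs are
labelled by the finite set `A`, so that `obj (Fin n)` is the usual `S_n`-module `P(n)`. -/

/-- The data of a symmetric `K`-linear operad, without the axioms: spaces of operations,
relabelling of inputs along bijections, the identity operation `I` (one input), and the partial
composition `comp a p q = p ∘_a q`, which inserts `q` at the input `a` of `p`. -/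
structure OperadData (K : Type u) [Field K] where
  obj : (A : Type) → [Finite A] → Type v
  [instAddCommGroup : ∀ (A : Type) [Finite A], AddCommGroup (obj A)]
  [instModule : ∀ (A : Type) [Finite A], Module K (obj A)]
  map : ∀ {A B : Type} [Finite A] [Finite B], A ≃ B → obj A →ₗ[K] obj B
  one : obj Unit
  comp : ∀ {A B : Type} [Finite A] [Finite B] (a : A),
    obj A →ₗ[K] obj B →ₗ[K] obj ({x : A // x ≠ a} ⊕ B)

attribute [instance] OperadData.instAddCommGroup OperadData.instModule

/-! ### The canonical bijections between sets of inputs -/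

/-- Inputs of `I ∘ q` are the inputs of `q`. -/
def leftUnitEquiv (B : Type) : {x : Unit // x ≠ ()} ⊕ B ≃ B where
  toFun := Sum.elim (fun x => (x.2 rfl).elim) id
  invFun := Sum.inr
  left_inv := by
    rintro (x | b)
    · exact (x.2 rfl).elim
    · rfl
  right_inv _ := rfl

/-- Inputs of `p ∘_a I` are the inputs of `p`, the input of `I` replacing `a`. -/
def rightUnitEquiv {A : Type} (a : A) : {x : A // x ≠ a} ⊕ Unit ≃ A :=
  Equiv.ofBijective (Sum.elim Subtype.val (fun _ => a)) (by
    constructor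
    · rintro (x | x) (y | y) h
      · exact congrArg Sum.inl (Subtype.ext h)
      · exact (x.2 h).elim
      · exact (y.2 h.symm).elim
      · rfl
    · intro x
      by_cases h : x = a
      · exact ⟨Sum.inr (), h.symm⟩
      · exact ⟨Sum.inl ⟨x, h⟩, rfl⟩)

/-- The inputs of `p ∘_a (q ∘_b r)` and of `(p ∘_a q) ∘_b r`. -/
def seqEquiv {A B : Type} (C : Type) (a : A) (b : B) :
    {x : A // x ≠ a} ⊕ ({y : B // y ≠ b} ⊕ C) ≃
      {z : {x : A // x ≠ a} ⊕ B // z ≠ Sum.inr b} ⊕ C where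
  toFun
    | Sum.inl x => Sum.inl ⟨Sum.inl x, Sum.inl_ne_inr⟩
    | Sum.inr (Sum.inl y) => Sum.inl ⟨Sum.inr y.1, fun h => y.2 (Sum.inr_injective h)⟩
    | Sum.inr (Sum.inr c) => Sum.inr c
  invFun
    | Sum.inl ⟨Sum.inl x, _⟩ => Sum.inl x
    | Sum.inl ⟨Sum.inr y, h⟩ => Sum.inr (Sum.inl ⟨y, fun e => h (congrArg Sum.inr e)⟩)
    | Sum.inr c => Sum.inr (Sum.inr c)
  left_inv := by rintro (x | y | c) <;> rfl
  right_inv := by rintro (⟨x | y, h⟩ | c) <;> rfl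

/-- The inputs of `(p ∘_a q) ∘_{a'} r` and of `(p ∘_{a'} r) ∘_a q`, for `a ≠ a'`. -/
def parEquiv {A : Type} (B C : Type) (a a' : A) (h : a ≠ a') :
    {z : {x : A // x ≠ a} ⊕ B // z ≠ Sum.inl ⟨a', h.symm⟩} ⊕ C ≃
      {z : {x : A // x ≠ a'} ⊕ C // z ≠ Sum.inl ⟨a, h⟩} ⊕ B where
  toFun
    | Sum.inl ⟨Sum.inl x, hx⟩ => Sum.inl
        ⟨Sum.inl ⟨x.1, fun e => hx (congrArg Sum.inl (Subtype.ext e))⟩,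
          fun e => x.2 (congrArg Subtype.val (Sum.inl_injective e))⟩
    | Sum.inl ⟨Sum.inr b, _⟩ => Sum.inr b
    | Sum.inr c => Sum.inl ⟨Sum.inr c, Sum.inr_ne_inl⟩
  invFun
    | Sum.inl ⟨Sum.inl x, hx⟩ => Sum.inl
        ⟨Sum.inl ⟨x.1, fun e => hx (congrArg Sum.inl (Subtype.ext e))⟩,
          fun e => x.2 (congrArg Subtype.val (Sum.inl_injective e))⟩
    | Sum.inl ⟨Sum.inr c, _⟩ => Sum.inr c
    | Sum.inr b => Sum.inl ⟨Sum.inr b, Sum.inr_ne_inl⟩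
  left_inv := by rintro (⟨x | b, hx⟩ | c) <;> rfl
  right_inv := by rintro (⟨x | c, hx⟩ | b) <;> rfl

/-- The bijection on the inputs of a composite induced by bijections on the inputs of the two
factors. -/
def compEquiv {A A' B B' : Type} (σ : A ≃ A') (τ : B ≃ B') (a : A) :
    {x : A // x ≠ a} ⊕ B ≃ {x : A' // x ≠ σ a} ⊕ B' :=
  Equiv.sumCongr (σ.subtypeEquiv (fun _ => σ.injective.ne_iff.symm)) τ

/-- The axioms of a symmetric operad: functoriality of relabelling, equivariance, unit laws,
sequential and parallel associativity of the partial compositions. -/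
structure OperadData.IsOperad {K : Type u} [Field K] (P : OperadData.{u, v} K) : Prop where
  map_refl : ∀ {A : Type} [Finite A] (p : P.obj A), P.map (Equiv.refl A) p = p
  map_trans : ∀ {A B C : Type} [Finite A] [Finite B] [Finite C] (σ : A ≃ B) (τ : B ≃ C)
    (p : P.obj A), P.map (σ.trans τ) p = P.map τ (P.map σ p)
  comp_map : ∀ {A A' B B' : Type} [Finite A] [Finite A'] [Finite B] [Finite B']
    (σ : A ≃ A') (τ : B ≃ B') (a : A) (p : P.obj A) (q : P.obj B),
    P.comp (σ a) (P.map σ p) (P.map τ q) = P.map (compEquiv σ τ a) (P.comp a p q)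
  one_comp : ∀ {B : Type} [Finite B] (q : P.obj B),
    P.map (leftUnitEquiv B) (P.comp () P.one q) = q
  comp_one : ∀ {A : Type} [Finite A] (a : A) (p : P.obj A),
    P.map (rightUnitEquiv a) (P.comp a p P.one) = p
  assoc_seq : ∀ {A B C : Type} [Finite A] [Finite B] [Finite C] (a : A) (b : B)
    (p : P.obj A) (q : P.obj B) (r : P.obj C),
    P.map (seqEquiv C a b) (P.comp a p (P.comp b q r)) = P.comp (Sum.inr b) (P.comp a p q) r
  assoc_par : ∀ {A B C : Type} [Finite A] [Finite B] [Finite C] (a a' : A) (h : a ≠ a')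
    (p : P.obj A) (q : P.obj B) (r : P.obj C),
    P.map (parEquiv B C a a' h) (P.comp (Sum.inl ⟨a', h.symm⟩) (P.comp a p q) r) =
      P.comp (Sum.inl ⟨a, h⟩) (P.comp a' p r) q

/-- A symmetric operad in `K`-vector spaces. -/
structure Operad (K : Type u) [Field K] extends OperadData.{u, v} K where
  isOperad : toOperadData.IsOperad

/-- Morphisms of operads. -/
structure Operad.Hom {K : Type u} [Field K] (P : Operad.{u, v} K) (Q : Operad.{u, w} K) where
  app : ∀ (A : Type) [Finite A], P.obj A →ₗ[K] Q.obj A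
  app_map : ∀ {A B : Type} [Finite A] [Finite B] (σ : A ≃ B) (p : P.obj A),
    app B (P.map σ p) = Q.map σ (app A p)
  app_one : app Unit P.one = Q.one
  app_comp : ∀ {A B : Type} [Finite A] [Finite B] (a : A) (p : P.obj A) (q : P.obj B),
    app ({x : A // x ≠ a} ⊕ B) (P.comp a p q) = Q.comp a (app A p) (app B q)

/-- A morphism of operads is an isomorphism when all its components are bijective. -/
def Operad.Hom.IsIso {K : Type u} [Field K] {P : Operad.{u, v} K} {Q : Operad.{u, w} K}
    (f : P.Hom Q) : Prop :=
  ∀ (A : Type) [Finite A], Function.Bijective (f.app A)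

/-- A morphism of operads exhibits its target as a quotient of its source when all its components
are surjective. -/
def Operad.Hom.IsQuotient {K : Type u} [Field K] {P : Operad.{u, v} K} {Q : Operad.{u, w} K}
    (f : P.Hom Q) : Prop :=
  ∀ (A : Type) [Finite A], Function.Surjective (f.app A)

/-! ## Operadic ideals and quotients -/

/-- Operadic ideals: families of subspaces stable under relabelling and under composition with
arbitrary operations on either side. -/
structure OperadData.Ideal {K : Type u} [Field K] (P : OperadData.{u, v} K) where
  carrier : ∀ (A : Type) [Finite A], Submodule K (P.obj A)
  map_mem : ∀ {A B : Type} [Finite A] [Finite B] (σ : A ≃ B) {p : P.obj A},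
    p ∈ carrier A → P.map σ p ∈ carrier B
  comp_mem_left : ∀ {A B : Type} [Finite A] [Finite B] (a : A) {p : P.obj A} (q : P.obj B),
    p ∈ carrier A → P.comp a p q ∈ carrier ({x : A // x ≠ a} ⊕ B)
  comp_mem_right : ∀ {A B : Type} [Finite A] [Finite B] (a : A) (p : P.obj A) {q : P.obj B},
    q ∈ carrier B → P.comp a p q ∈ carrier ({x : A // x ≠ a} ⊕ B)

/-- The intersection of a set of ideals. -/
def OperadData.Ideal.inter {K : Type u} [Field K] {P : OperadData.{u, v} K} (S : Set P.Ideal) :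
    P.Ideal where
  carrier A _ := ⨅ I ∈ S, I.carrier A
  map_mem σ p hp := by
    simp only [Submodule.mem_iInf] at hp ⊢
    exact fun I hI => I.map_mem σ (hp I hI)
  comp_mem_left a p q hp := by
    simp only [Submodule.mem_iInf] at hp ⊢
    exact fun I hI => I.comp_mem_left a q (hp I hI)
  comp_mem_right a p q hq := by
    simp only [Submodule.mem_iInf] at hq ⊢
    exact fun I hI => I.comp_mem_right a p (hq I hI)

theorem OperadData.Ideal.mem_inter {K : Type u} [Field K] {P : OperadData.{u, v} K}
    {S : Set P.Ideal} {A : Type} [Finite A] {p : P.obj A} :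
    p ∈ (inter S).carrier A ↔ ∀ I ∈ S, p ∈ I.carrier A := by
  simp only [inter, Submodule.mem_iInf]

/-- The quotient by an ideal, with the induced operations. -/
def OperadData.quotient {K : Type u} [Field K] (P : OperadData.{u, v} K) (I : P.Ideal) :
    OperadData.{u, v} K where
  obj A _ := P.obj A ⧸ I.carrier A
  map σ := (I.carrier _).mapQ (I.carrier _) (P.map σ) (fun _ hp => I.map_mem σ hp)
  one := (I.carrier Unit).mkQ P.one
  comp a := (I.carrier _).liftQ
    { toFun := fun p => (I.carrier _).mapQ (I.carrier _) (P.comp a p)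
        (fun _ hq => I.comp_mem_right a p hq)
      map_add' := fun p p' => by
        refine Submodule.linearMap_qext _ (LinearMap.ext fun q => ?_)
        simp
      map_smul' := fun c p => by
        refine Submodule.linearMap_qext _ (LinearMap.ext fun q => ?_)
        simp }
    (fun p hp => by
      refine LinearMap.mem_ker.2 (Submodule.linearMap_qext _ (LinearMap.ext fun q => ?_))
      exact (Submodule.Quotient.mk_eq_zero _).2 (I.comp_mem_left a q hp))

/-- The quotient of an operad by an ideal is an operad. -/
def Operad.quotient {K : Type u} [Field K] (P : Operad.{u, v} K) (I : P.Ideal) :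
    Operad.{u, v} K where
  toOperadData := P.toOperadData.quotient I
  isOperad :=
    { map_refl := by
        rintro A _ ⟨p⟩
        exact congrArg (I.carrier _).mkQ (P.isOperad.map_refl p)
      map_trans := by
        rintro A B C _ _ _ σ τ ⟨p⟩
        exact congrArg (I.carrier _).mkQ (P.isOperad.map_trans σ τ p)
      comp_map := by
        rintro A A' B B' _ _ _ _ σ τ a ⟨p⟩ ⟨q⟩
        exact congrArg (I.carrier _).mkQ (P.isOperad.comp_map σ τ a p q)
      one_comp := by
        rintro B _ ⟨q⟩
        exact congrArg (I.carrier _).mkQ (P.isOperad.one_comp q)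
      comp_one := by
        rintro A _ a ⟨p⟩
        exact congrArg (I.carrier _).mkQ (P.isOperad.comp_one a p)
      assoc_seq := by
        rintro A B C _ _ _ a b ⟨p⟩ ⟨q⟩ ⟨r⟩
        exact congrArg (I.carrier _).mkQ (P.isOperad.assoc_seq a b p q r)
      assoc_par := by
        rintro A B C _ _ _ a a' h ⟨p⟩ ⟨q⟩ ⟨r⟩
        exact congrArg (I.carrier _).mkQ (P.isOperad.assoc_par a a' h p q r) }

/-- The ideal generated by a space of operations with three inputs. -/
def Operad.idealSpan {K : Type u} [Field K] (P : Operad.{u, v} K)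
    (R : Submodule K (P.obj (Fin 3))) : P.Ideal :=
  OperadData.Ideal.inter {I | R ≤ I.carrier (Fin 3)}

/-! ## The free operad on an `S_2`-module -/

/-- Formal composites of binary operations from `E`, with inputs labelled by a finite set. -/
inductive Term (E : Type v) : (A : Type) → [Finite A] → Type (max 1 v)
  | one : Term E Unit
  | gen (e : E) : Term E (Fin 2)
  | map {A B : Type} [Finite A] [Finite B] (σ : A ≃ B) (s : Term E A) : Term E B
  | comp {A B : Type} [Finite A] [Finite B] (a : A) (s : Term E A) (t : Term E B) :
      Term E ({x : A // x ≠ a} ⊕ B)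

/-- Linear combinations of formal composites, before any axiom is imposed. -/
def termData (K : Type u) [Field K] (E : Type v) : OperadData.{u, max 1 u v} K where
  obj A _ := Term E A →₀ K
  map σ := Finsupp.lmapDomain K K (Term.map σ)
  one := Finsupp.single Term.one 1
  comp a := Finsupp.linearCombination K (fun s => Finsupp.lmapDomain K K (Term.comp a s))

section Free

variable {K : Type u} [Field K] {E : Type v} [AddCommGroup E] [Module K E]

/-- The ideals of formal composites modulo which the axioms of an operad hold and `E` maps
linearly and `S_2`-equivariantly to the binary operations. -/
structure IsFreeIdeal (ρ : Representation K (Equiv.Perm (Fin 2)) E)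
    (I : (termData K E).Ideal) : Prop where
  isOperad : ((termData K E).quotient I).IsOperad
  gen_add : ∀ e e' : E, (Finsupp.single (Term.gen (e + e')) 1 - (Finsupp.single (Term.gen e) 1 +
    Finsupp.single (Term.gen e') 1) : Term E (Fin 2) →₀ K) ∈ I.carrier (Fin 2)
  gen_smul : ∀ (c : K) (e : E), (Finsupp.single (Term.gen (c • e)) 1 -
    c • Finsupp.single (Term.gen e) 1 : Term E (Fin 2) →₀ K) ∈ I.carrier (Fin 2)
  gen_map : ∀ (σ : Equiv.Perm (Fin 2)) (e : E), (Finsupp.single (Term.gen (ρ σ e)) 1 -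
    Finsupp.single (Term.map σ (Term.gen e)) 1 : Term E (Fin 2) →₀ K) ∈ I.carrier (Fin 2)

/-- The smallest such ideal. -/
def freeIdeal (ρ : Representation K (Equiv.Perm (Fin 2)) E) : (termData K E).Ideal :=
  OperadData.Ideal.inter {I | IsFreeIdeal ρ I}

theorem isFreeIdeal_freeIdeal (ρ : Representation K (Equiv.Perm (Fin 2)) E) :
    IsFreeIdeal ρ (freeIdeal ρ) where
  isOperad :=
    { map_refl := by
        rintro A _ ⟨p⟩
        refine (Submodule.Quotient.eq _).2 (OperadData.Ideal.mem_inter.2 fun I hI => ?_)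
        exact (Submodule.Quotient.eq _).1 (hI.isOperad.map_refl (Submodule.Quotient.mk p))
      map_trans := by
        rintro A B C _ _ _ σ τ ⟨p⟩
        refine (Submodule.Quotient.eq _).2 (OperadData.Ideal.mem_inter.2 fun I hI => ?_)
        exact (Submodule.Quotient.eq _).1 (hI.isOperad.map_trans σ τ (Submodule.Quotient.mk p))
      comp_map := by
        rintro A A' B B' _ _ _ _ σ τ a ⟨p⟩ ⟨q⟩
        refine (Submodule.Quotient.eq _).2 (OperadData.Ideal.mem_inter.2 fun I hI => ?_)
        exact (Submodule.Quotient.eq _).1 (hI.isOperad.comp_map σ τ a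
          (Submodule.Quotient.mk p) (Submodule.Quotient.mk q))
      one_comp := by
        rintro B _ ⟨q⟩
        refine (Submodule.Quotient.eq _).2 (OperadData.Ideal.mem_inter.2 fun I hI => ?_)
        exact (Submodule.Quotient.eq _).1 (hI.isOperad.one_comp (Submodule.Quotient.mk q))
      comp_one := by
        rintro A _ a ⟨p⟩
        refine (Submodule.Quotient.eq _).2 (OperadData.Ideal.mem_inter.2 fun I hI => ?_)
        exact (Submodule.Quotient.eq _).1 (hI.isOperad.comp_one a (Submodule.Quotient.mk p))
      assoc_seq := by
        rintro A B C _ _ _ a b ⟨p⟩ ⟨q⟩ ⟨r⟩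
        refine (Submodule.Quotient.eq _).2 (OperadData.Ideal.mem_inter.2 fun I hI => ?_)
        exact (Submodule.Quotient.eq _).1 (hI.isOperad.assoc_seq a b (Submodule.Quotient.mk p)
          (Submodule.Quotient.mk q) (Submodule.Quotient.mk r))
      assoc_par := by
        rintro A B C _ _ _ a a' h ⟨p⟩ ⟨q⟩ ⟨r⟩
        refine (Submodule.Quotient.eq _).2 (OperadData.Ideal.mem_inter.2 fun I hI => ?_)
        exact (Submodule.Quotient.eq _).1 (hI.isOperad.assoc_par a a' h (Submodule.Quotient.mk p)
          (Submodule.Quotient.mk q) (Submodule.Quotient.mk r)) }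
  gen_add e e' := OperadData.Ideal.mem_inter.2 fun _ hI => hI.gen_add e e'
  gen_smul c e := OperadData.Ideal.mem_inter.2 fun _ hI => hI.gen_smul c e
  gen_map σ e := OperadData.Ideal.mem_inter.2 fun _ hI => hI.gen_map σ e

/-- The free operad `F(E)` on the `S_2`-module `E`. -/
def freeOperad (ρ : Representation K (Equiv.Perm (Fin 2)) E) : Operad.{u, max 1 u v} K where
  toOperadData := (termData K E).quotient (freeIdeal ρ)
  isOperad := (isFreeIdeal_freeIdeal ρ).isOperad

/-- The inclusion of generators `E → F(E)(2)`. -/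
def freeGen (ρ : Representation K (Equiv.Perm (Fin 2)) E) :
    E →ₗ[K] (freeOperad ρ).obj (Fin 2) where
  toFun e := ((freeIdeal ρ).carrier (Fin 2)).mkQ (Finsupp.single (Term.gen e) 1)
  map_add' e e' := (Submodule.Quotient.eq _).2 ((isFreeIdeal_freeIdeal ρ).gen_add e e')
  map_smul' c e := (Submodule.Quotient.eq _).2 ((isFreeIdeal_freeIdeal ρ).gen_smul c e)

end Free

/-! ## Binary quadratic operads and their Koszul duals -/

/-- Inputs `1, 2` of the inserted operation become `1, 2`; the remaining input becomes `3`. -/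
def leftEquiv : {x : Fin 2 // x ≠ 0} ⊕ Fin 2 ≃ Fin 3 :=
  Equiv.ofBijective (Sum.elim (fun _ => 2) ![0, 1]) (by decide)

/-- The remaining input becomes `1`; inputs `1, 2` of the inserted operation become `2, 3`. -/
def rightEquiv : {x : Fin 2 // x ≠ 1} ⊕ Fin 2 ≃ Fin 3 :=
  Equiv.ofBijective (Sum.elim (fun _ => 0) ![1, 2]) (by decide)

section Quadratic

variable {K : Type u} [Field K]

/-- `p ∘ (q, I)`: the operation `p(q(x₁, x₂), x₃)`. -/
def Operad.compLeft (P : Operad.{u, v} K) :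
    P.obj (Fin 2) →ₗ[K] P.obj (Fin 2) →ₗ[K] P.obj (Fin 3) :=
  (P.comp (0 : Fin 2)).compr₂ (P.map leftEquiv)

/-- `p ∘ (I, q)`: the operation `p(x₁, q(x₂, x₃))`. -/
def Operad.compRight (P : Operad.{u, v} K) :
    P.obj (Fin 2) →ₗ[K] P.obj (Fin 2) →ₗ[K] P.obj (Fin 3) :=
  (P.comp (1 : Fin 2)).compr₂ (P.map rightEquiv)

/-- The sub-`S_3`-module of `P(3)` generated by a set of operations. -/
def Operad.symSpan (P : Operad.{u, v} K) (S : Set (P.obj (Fin 3))) :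
    Submodule K (P.obj (Fin 3)) :=
  Submodule.span K {y | ∃ σ : Equiv.Perm (Fin 3), ∃ x ∈ S, y = P.map σ x}

variable {E : Type v} [AddCommGroup E] [Module K E]

/-- The quadratic operad `P(E, R) = F(E) / (R)`. -/
def quadraticOperad (ρ : Representation K (Equiv.Perm (Fin 2)) E)
    (R : Submodule K ((freeOperad ρ).obj (Fin 3))) : Operad.{u, max 1 u v} K :=
  (freeOperad ρ).quotient ((freeOperad ρ).idealSpan R)

/-- The class in `P(E, R)(2)` of a generator. -/
def quadraticGen (ρ : Representation K (Equiv.Perm (Fin 2)) E)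
    (R : Submodule K ((freeOperad ρ).obj (Fin 3))) (e : E) :
    (quadraticOperad ρ R).obj (Fin 2) :=
  (((freeOperad ρ).idealSpan R).carrier (Fin 2)).mkQ (freeGen ρ e)

/-- The `S_2`-module `E^∨ = E^* ⊗ sgn`. -/
def signDual (ρ : Representation K (Equiv.Perm (Fin 2)) E) :
    Representation K (Equiv.Perm (Fin 2)) (Module.Dual K E) where
  toFun σ := ((Equiv.Perm.sign σ : ℤ) : K) • ρ.dual σ
  map_one' := by rw [map_one, map_one, Units.val_one, Int.cast_one, one_smul]
  map_mul' σ τ := by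
    rw [map_mul, map_mul, Units.val_mul, Int.cast_mul, smul_mul_smul_comm]

/-- The canonical identification of `(E ⊗ E)³` with `F(E)(3)`: the summand of index `u` is sent to
the operations `μ(ν(x_i, x_j), x_k)` with `(i, j, k)` the `u`-th cyclic permutation of
`(1, 2, 3)`. -/
def treeMap (ρ : Representation K (Equiv.Perm (Fin 2)) E) :
    (Fin 3 → E ⊗[K] E) →ₗ[K] (freeOperad ρ).obj (Fin 3) :=
  ∑ u : Fin 3, (freeOperad ρ).map (finRotate 3 ^ (u : ℕ)) ∘ₗ
    TensorProduct.lift ((freeOperad ρ).compLeft.compl₁₂ (freeGen ρ) (freeGen ρ)) ∘ₗ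
      LinearMap.proj u

/-- The pairing between `(E^* ⊗ E^*)³` and `(E ⊗ E)³` given by
`⟨α ⊗ β, μ ⊗ ν⟩ = α(μ) β(ν)` on summands of the same index, and by `0` on summands of different
indices. -/
def treePairing (K : Type u) [Field K] (E : Type v) [AddCommGroup E] [Module K E] :
    (Fin 3 → Module.Dual K E ⊗[K] Module.Dual K E) →ₗ[K] Module.Dual K (Fin 3 → E ⊗[K] E) :=
  ∑ u : Fin 3, (Module.Dual.transpose (R := K) (LinearMap.proj u)) ∘ₗ
    TensorProduct.dualDistrib K E E ∘ₗ LinearMap.proj u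

/-- The orthogonal `R^⊥ ⊆ F(E^∨)(3)` of a sub-`S_3`-module `R ⊆ F(E)(3)`, for the pairing
above transported along the identifications of `F(E^∨)(3)` and `F(E)(3)` with sums of tensor
products. -/
def orthogonal (ρ : Representation K (Equiv.Perm (Fin 2)) E)
    (R : Submodule K ((freeOperad ρ).obj (Fin 3))) :
    Submodule K ((freeOperad (signDual ρ)).obj (Fin 3)) :=
  (((R.comap (treeMap ρ)).dualAnnihilator).comap (treePairing K E)).map (treeMap (signDual ρ))

/-- The Koszul dual `P(E, R)^! = P(E^∨, R^⊥)` of the quadratic operad `P(E, R)`, for `E` of finite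
dimension and `R` a sub-`S_3`-module of `F(E)(3)`. -/
def koszulDual [FiniteDimensional K E] (ρ : Representation K (Equiv.Perm (Fin 2)) E)
    (R : Submodule K ((freeOperad ρ).obj (Fin 3))) : Operad.{u, max 1 u v} K :=
  quadraticOperad (signDual ρ) (orthogonal ρ R)

/-- The class in `P(E, R)^!(2)` of an element of `E^∨`. -/
def koszulDualGen [FiniteDimensional K E] (ρ : Representation K (Equiv.Perm (Fin 2)) E)
    (R : Submodule K ((freeOperad ρ).obj (Fin 3))) (f : Module.Dual K E) :
    (koszulDual ρ R).obj (Fin 2) :=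
  quadraticGen (signDual ρ) (orthogonal ρ R) f

end Quadratic

/-! ## The operad `P_↘` -/

/-- The two generators `m` and `↘`. -/
inductive Gen
  | m
  | se

instance : Finite Gen :=
  Finite.of_surjective (fun b : Bool => bif b then Gen.m else Gen.se) (by
    rintro (_ | _)
    · exact ⟨true, rfl⟩
    · exact ⟨false, rfl⟩)

section Forests

variable (K : Type u) [Field K]

/-- The free `S_2`-module on `m` and `↘`. -/
abbrev genRep : Representation K (Equiv.Perm (Fin 2))
    (Gen →₀ MonoidAlgebra K (Equiv.Perm (Fin 2))) :=
  Representation.free K (Equiv.Perm (Fin 2)) Gen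

/-- A generator, as a basis element of the free `S_2`-module. -/
def genElt (g : Gen) : Gen →₀ MonoidAlgebra K (Equiv.Perm (Fin 2)) :=
  Finsupp.single g 1

/-- The element `g^*` of the dual basis: the linear form on the free `S_2`-module which takes the
value `1` at `g` and `0` at the other elements `σ · g'` of the basis. -/
def genDual (g : Gen) : Module.Dual K (Gen →₀ MonoidAlgebra K (Equiv.Perm (Fin 2))) where
  toFun x := (x g).coeff 1
  map_add' _ _ := rfl
  map_smul' _ _ := rfl

/-- The operations `m` and `↘` in the free operad. -/
def freeOp (g : Gen) : (freeOperad (genRep K)).obj (Fin 2) :=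
  freeGen (genRep K) (genElt K g)

/-- The relations of `P_↘`: `↘∘(m,I) = ↘∘(I,↘)`, `↘∘(I,m) = m∘(↘,I)`, `m∘(m,I) = m∘(I,m)`. -/
def seRelations : Set ((freeOperad (genRep K)).obj (Fin 3)) :=
  let F := freeOperad (genRep K)
  let m := freeOp K Gen.m
  let s := freeOp K Gen.se
  {F.compLeft s m - F.compRight s s,
   F.compRight s m - F.compLeft m s,
   F.compLeft m m - F.compRight m m}

/-- The relations of the theorem: `↘∘(m,I) = ↘∘(I,↘)`, `m∘(m,I) = m∘(I,m)`,
`m∘(↘,I) = ↘∘(I,m)`, `↘∘(↘,I) = 0`, `m∘(I,↘) = 0`. -/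
def seDualRelations : Set ((freeOperad (genRep K)).obj (Fin 3)) :=
  let F := freeOperad (genRep K)
  let m := freeOp K Gen.m
  let s := freeOp K Gen.se
  {F.compLeft s m - F.compRight s s,
   F.compLeft m m - F.compRight m m,
   F.compLeft m s - F.compRight s m,
   F.compLeft s s,
   F.compRight m s}

/-- The operad generated by `m` and `↘` with relations `r = 0`, for `r` in `S`. -/
def presentedOperad (S : Set ((freeOperad (genRep K)).obj (Fin 3))) : Operad.{u, max 1 u} K :=
  quadraticOperad (genRep K) ((freeOperad (genRep K)).symSpan S)

/-- The generators of a presented operad. -/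
def presentedGen (S : Set ((freeOperad (genRep K)).obj (Fin 3))) (g : Gen) :
    (presentedOperad K S).obj (Fin 2) :=
  quadraticGen (genRep K) ((freeOperad (genRep K)).symSpan S) (genElt K g)

/-- The operad `P_↘`. -/
def seOperad : Operad.{u, max 1 u} K :=
  presentedOperad K (seRelations K)

/-- The generators `m` and `↘` of `P_↘`. -/
def seGen (g : Gen) : (seOperad K).obj (Fin 2) :=
  presentedGen K (seRelations K) g

/-- The Koszul dual `P_↘^!`. -/
def seKoszulDual : Operad.{u, max 1 u} K :=
  koszulDual (genRep K) ((freeOperad (genRep K)).symSpan (seRelations K))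

/-- The operations `m` and `↘` of `P_↘^!`: the classes of the dual basis elements `m^*`, `↘^*`. -/
def seKoszulDualGen (g : Gen) : (seKoszulDual K).obj (Fin 2) :=
  koszulDualGen (genRep K) ((freeOperad (genRep K)).symSpan (seRelations K)) (genDual K g)

end Forests

end SymOperad

end

/-! The `S_2`-module `E` is free, so it is isomorphic to `E^∨`: sending `σ · g` to `sgn(σ) (σ ·
g)^*` is equivariant, and it sends `g` to `g^*`. It induces an isomorphism `F(E) ≅ F(E^∨)`, and
everything reduces to computing, inside `F(E)(3)`, the subspace that corresponds to `R^⊥`.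

The space `F(E)(3)` has a basis of 48 trees: the left trees `π · (g ∘ (h, I))` and the right trees
`π · (g ∘ (I, h))`, with `π` in `S_3`. Transported along `E ≅ E^∨`, the pairing is diagonal in this
basis, with value `sgn(π)` on left trees and `-sgn(π)` on right trees (`treePairing_treeBasis`).

For each `π`, the three relations of `P_↘` are, up to sign, differences of a left and a right tree,
and no tree occurs twice. A vector is orthogonal to such a difference when its two coordinates,
weighted by opposite signs, agree, that is, when they are opposite. Hence the same three differences
span the part of the orthogonal supported on these six trees. The two remaining trees, `↘∘(↘,I)` and
`m∘(I,↘)`, occur in no relation and lie in the orthogonal. This gives the five relations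
(`map_symSpan_seDualRelations`). Since they contain the three relations of `P_↘` up to sign, the
quotient map follows.

The delicate point is the independence of the 48 trees, because the free operad is defined as a
quotient by a smallest ideal. It is proved by letting `F(E)` act on bracketed words, where different
trees act by different functions (`linearIndependent_treeOp`). -/

noncomputable section

open scoped TensorProduct

namespace SymOperad

universe u v w x

/-! ### Morphisms, ideals and quotients of operads -/

section Homs

variable {K : Type u} [Field K]

/-- Composition of morphisms of operads. -/
def Operad.Hom.trans {P : Operad.{u, v} K} {Q : Operad.{u, w} K} {R : Operad.{u, x} K}
    (f : P.Hom Q) (g : Q.Hom R) : P.Hom R where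
  app A _ := g.app A ∘ₗ f.app A
  app_map σ p := by simp [f.app_map, g.app_map]
  app_one := by simp [f.app_one, g.app_one]
  app_comp a p q := by simp [f.app_comp, g.app_comp]

/-- The preimage of an ideal under a morphism of operads. -/
def Operad.Hom.comapIdeal {P : Operad.{u, v} K} {Q : Operad.{u, w} K} (f : P.Hom Q)
    (I : Q.Ideal) : P.Ideal where
  carrier A _ := (I.carrier A).comap (f.app A)
  map_mem σ p hp := by
    rw [Submodule.mem_comap, f.app_map]
    exact I.map_mem σ hp
  comp_mem_left a p q hp := by
    rw [Submodule.mem_comap, f.app_comp]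
    exact I.comp_mem_left a _ hp
  comp_mem_right a p q hq := by
    rw [Submodule.mem_comap, f.app_comp]
    exact I.comp_mem_right a _ hq

theorem Operad.le_idealSpan (P : Operad.{u, v} K) (R : Submodule K (P.obj (Fin 3))) :
    R ≤ (P.idealSpan R).carrier (Fin 3) :=
  fun _ hp => OperadData.Ideal.mem_inter.2 fun _ hI => hI hp

theorem Operad.idealSpan_le (P : Operad.{u, v} K) {R : Submodule K (P.obj (Fin 3))}
    {I : P.Ideal} (h : R ≤ I.carrier (Fin 3)) (A : Type) [Finite A] :
    (P.idealSpan R).carrier A ≤ I.carrier A :=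
  fun _ hp => OperadData.Ideal.mem_inter.1 hp I h

/-- The morphism induced on quotients by ideals. -/
def Operad.Hom.quotientMap {P : Operad.{u, v} K} {Q : Operad.{u, w} K} (f : P.Hom Q)
    (I : P.Ideal) (J : Q.Ideal)
    (h : ∀ (A : Type) [Finite A], I.carrier A ≤ (f.comapIdeal J).carrier A) :
    (P.quotient I).Hom (Q.quotient J) where
  app A _ := (I.carrier A).mapQ (J.carrier A) (f.app A) (h A)
  app_map := by
    rintro A B _ _ σ ⟨p⟩
    exact congrArg (J.carrier B).mkQ (f.app_map σ p)
  app_one := congrArg (J.carrier Unit).mkQ f.app_one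
  app_comp := by
    rintro A B _ _ a ⟨p⟩ ⟨q⟩
    exact congrArg (J.carrier _).mkQ (f.app_comp a p q)

end Homs

/-! ### Formal composites and the universal property of the free operad -/

section TermMk

variable {K : Type u} [Field K] {E : Type v}

/-- A formal composite as an element of the space of linear combinations. -/
def termMk (K : Type u) [Field K] {E : Type v} {A : Type} [Finite A] (s : Term E A) :
    (termData K E).obj A :=
  (Finsupp.single s 1 : Term E A →₀ K)

theorem termData_hom_ext {A : Type} [Finite A] {M : Type*} [AddCommGroup M] [Module K M]
    {f g : (termData K E).obj A →ₗ[K] M} (h : ∀ s, f (termMk K s) = g (termMk K s)) : f = g :=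
  Finsupp.lhom_ext' fun s => LinearMap.ext_ring (h s)

theorem termData_map_termMk {A B : Type} [Finite A] [Finite B] (σ : A ≃ B) (s : Term E A) :
    (termData K E).map σ (termMk K s) = termMk K (Term.map σ s) :=
  Finsupp.mapDomain_single

theorem termData_comp_termMk {A B : Type} [Finite A] [Finite B] (a : A) (s : Term E A)
    (t : Term E B) :
    (termData K E).comp a (termMk K s) (termMk K t) = termMk K (Term.comp a s t) := by
  change Finsupp.linearCombination K
    (fun s : Term E A => (Finsupp.lmapDomain K K (Term.comp a s) :
      (Term E B →₀ K) →ₗ[K] Term E ({x : A // x ≠ a} ⊕ B) →₀ K)) (Finsupp.single s 1)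
    (Finsupp.single t 1) = Finsupp.single (Term.comp a s t) 1
  rw [Finsupp.linearCombination_single, one_smul, Finsupp.lmapDomain_apply,
    Finsupp.mapDomain_single]

end TermMk

section FreeLift

variable {K : Type u} [Field K] {E : Type v} [AddCommGroup E] [Module K E]

/-- The value of a formal composite in an operad. -/
def Term.eval (Q : Operad.{u, w} K) (f : E →ₗ[K] Q.obj (Fin 2)) :
    ∀ {A : Type} [Finite A], Term E A → Q.obj A
  | _, _, .one => Q.one
  | _, _, .gen e => f e
  | _, _, @Term.map _ _ _ _ _ σ s => Q.map σ (s.eval Q f)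
  | _, _, @Term.comp _ _ _ _ _ a s t => Q.comp a (s.eval Q f) (t.eval Q f)

/-- The linear extension of `Term.eval`. -/
def evalLin (Q : Operad.{u, w} K) (f : E →ₗ[K] Q.obj (Fin 2)) (A : Type) [Finite A] :
    (termData K E).obj A →ₗ[K] Q.obj A :=
  Finsupp.linearCombination K (fun s : Term E A => s.eval Q f)

variable (Q : Operad.{u, w} K) (f : E →ₗ[K] Q.obj (Fin 2))

theorem evalLin_termMk {A : Type} [Finite A] (s : Term E A) :
    evalLin Q f A (termMk K s) = s.eval Q f :=
  (Finsupp.linearCombination_single K (1 : K) s).trans (one_smul K _)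

theorem evalLin_map {A B : Type} [Finite A] [Finite B] (σ : A ≃ B) (p : (termData K E).obj A) :
    evalLin Q f B ((termData K E).map σ p) = Q.map σ (evalLin Q f A p) := by
  suffices h : evalLin Q f B ∘ₗ (termData K E).map σ = Q.map σ ∘ₗ evalLin Q f A from
    LinearMap.congr_fun h p
  refine termData_hom_ext fun s => ?_
  rw [LinearMap.comp_apply, LinearMap.comp_apply, termData_map_termMk, evalLin_termMk,
    evalLin_termMk]
  rfl

theorem evalLin_comp {A B : Type} [Finite A] [Finite B] (a : A) (p : (termData K E).obj A)
    (q : (termData K E).obj B) :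
    evalLin Q f _ ((termData K E).comp a p q) =
      Q.comp a (evalLin Q f A p) (evalLin Q f B q) := by
  suffices h : ((termData K E).comp a).compr₂ (evalLin Q f _) =
      (Q.comp a).compl₁₂ (evalLin Q f A) (evalLin Q f B) from
    LinearMap.congr_fun₂ h p q
  refine termData_hom_ext fun s => termData_hom_ext fun t => ?_
  rw [LinearMap.compr₂_apply, LinearMap.compl₁₂_apply, termData_comp_termMk, evalLin_termMk,
    evalLin_termMk, evalLin_termMk]
  rfl

theorem evalLin_one : evalLin Q f Unit (termData K E).one = Q.one :=
  evalLin_termMk Q f Term.one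

/-- The formal composites which vanish in an operad. -/
def evalKer : (termData K E).Ideal where
  carrier A _ := LinearMap.ker (evalLin Q f A)
  map_mem σ p hp := by
    rw [LinearMap.mem_ker] at hp ⊢
    rw [evalLin_map, hp, map_zero]
  comp_mem_left a p q hp := by
    rw [LinearMap.mem_ker] at hp ⊢
    rw [evalLin_comp, hp, map_zero, LinearMap.zero_apply]
  comp_mem_right a p q hq := by
    rw [LinearMap.mem_ker] at hq ⊢
    rw [evalLin_comp, hq, map_zero]

/-- Reduces each operad axiom in the quotient by `evalKer` to the same axiom in `Q`. -/
theorem mk_evalKer_eq {A : Type} [Finite A] {p q : (termData K E).obj A}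
    (h : evalLin Q f A p = evalLin Q f A q) :
    ((evalKer Q f).carrier A).mkQ p = ((evalKer Q f).carrier A).mkQ q := by
  refine (Submodule.Quotient.eq _).2 (LinearMap.mem_ker.2 ?_)
  rw [map_sub, h, sub_self]

variable {ρ : Representation K (Equiv.Perm (Fin 2)) E}
  (hf : ∀ (σ : Equiv.Perm (Fin 2)) (e : E), f (ρ σ e) = Q.map σ (f e))

include hf in
-- The quotient by the kernel of evaluation embeds in `Q` and inherits its axioms. As `freeIdeal` is
-- the smallest ideal of this kind, evaluation factors through the free operad.
theorem isFreeIdeal_evalKer : IsFreeIdeal ρ (evalKer Q f) where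
  isOperad :=
    { map_refl := by
        rintro A _ ⟨p⟩
        refine mk_evalKer_eq Q f ?_
        rw [evalLin_map, Q.isOperad.map_refl]
      map_trans := by
        rintro A B C _ _ _ σ τ ⟨p⟩
        refine mk_evalKer_eq Q f ?_
        simp only [evalLin_map, Q.isOperad.map_trans]
      comp_map := by
        rintro A A' B B' _ _ _ _ σ τ a ⟨p⟩ ⟨q⟩
        refine mk_evalKer_eq Q f ?_
        simp only [evalLin_map, evalLin_comp, Q.isOperad.comp_map]
      one_comp := by
        rintro B _ ⟨q⟩
        refine mk_evalKer_eq Q f ?_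
        simp only [evalLin_map, evalLin_comp, evalLin_one, Q.isOperad.one_comp]
      comp_one := by
        rintro A _ a ⟨p⟩
        refine mk_evalKer_eq Q f ?_
        simp only [evalLin_map, evalLin_comp, evalLin_one, Q.isOperad.comp_one]
      assoc_seq := by
        rintro A B C _ _ _ a b ⟨p⟩ ⟨q⟩ ⟨r⟩
        refine mk_evalKer_eq Q f ?_
        simp only [evalLin_map, evalLin_comp, Q.isOperad.assoc_seq]
      assoc_par := by
        rintro A B C _ _ _ a a' h ⟨p⟩ ⟨q⟩ ⟨r⟩
        refine mk_evalKer_eq Q f ?_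
        simp only [evalLin_map, evalLin_comp, Q.isOperad.assoc_par] }
  gen_add e e' := by
    change evalLin Q f (Fin 2) (termMk K (Term.gen (e + e')) -
      (termMk K (Term.gen e) + termMk K (Term.gen e'))) = 0
    simp only [map_sub, map_add, evalLin_termMk, Term.eval, sub_self]
  gen_smul c e := by
    change evalLin Q f (Fin 2) (termMk K (Term.gen (c • e)) - c • termMk K (Term.gen e)) = 0
    simp only [map_sub, map_smul, evalLin_termMk, Term.eval, sub_self]
  gen_map σ e := by
    change evalLin Q f (Fin 2) (termMk K (Term.gen (ρ σ e)) -
      termMk K (Term.map σ (Term.gen e))) = 0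
    simp only [map_sub, evalLin_termMk, Term.eval, hf, sub_self]

include hf in
theorem freeIdeal_le_evalKer (A : Type) [Finite A] :
    (freeIdeal ρ).carrier A ≤ LinearMap.ker (evalLin Q f A) :=
  fun _ hp => OperadData.Ideal.mem_inter.1 hp _ (isFreeIdeal_evalKer Q f hf)

/-- The morphism from the free operad which extends an equivariant map on generators. -/
def freeLift : (freeOperad ρ).Hom Q where
  app A _ := ((freeIdeal ρ).carrier A).liftQ (evalLin Q f A) (freeIdeal_le_evalKer Q f hf A)
  app_map := by
    rintro A B _ _ σ ⟨p⟩
    exact evalLin_map Q f σ p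
  app_one := evalLin_one Q f
  app_comp := by
    rintro A B _ _ a ⟨p⟩ ⟨q⟩
    exact evalLin_comp Q f a p q

theorem freeLift_freeGen (e : E) : (freeLift Q f hf).app (Fin 2) (freeGen ρ e) = f e :=
  evalLin_termMk Q f (Term.gen e)

/-- The class of a formal composite in the free operad. -/
def freeMk (ρ : Representation K (Equiv.Perm (Fin 2)) E) {A : Type} [Finite A] (s : Term E A) :
    (freeOperad ρ).obj A :=
  ((freeIdeal ρ).carrier A).mkQ (termMk K s)

theorem freeOperad_linearMap_ext {A : Type} [Finite A] {M : Type*} [AddCommGroup M] [Module K M]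
    {f g : (freeOperad ρ).obj A →ₗ[K] M} (h : ∀ s, f (freeMk ρ s) = g (freeMk ρ s)) : f = g :=
  Submodule.linearMap_qext _ (termData_hom_ext h)

theorem freeOperad_map_freeMk {A B : Type} [Finite A] [Finite B] (σ : A ≃ B) (s : Term E A) :
    (freeOperad ρ).map σ (freeMk ρ s) = freeMk ρ (Term.map σ s) :=
  congrArg ((freeIdeal ρ).carrier B).mkQ (termData_map_termMk σ s)

theorem freeOperad_comp_freeMk {A B : Type} [Finite A] [Finite B] (a : A) (s : Term E A)
    (t : Term E B) :
    (freeOperad ρ).comp a (freeMk ρ s) (freeMk ρ t) = freeMk ρ (Term.comp a s t) :=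
  congrArg ((freeIdeal ρ).carrier _).mkQ (termData_comp_termMk a s t)

theorem freeGen_rep (σ : Equiv.Perm (Fin 2)) (e : E) :
    freeGen ρ (ρ σ e) = (freeOperad ρ).map σ (freeGen ρ e) := by
  refine Eq.trans ?_ (freeOperad_map_freeMk σ (Term.gen e)).symm
  exact (Submodule.Quotient.eq _).2 ((isFreeIdeal_freeIdeal ρ).gen_map σ e)

/-- An endomorphism of the free operad which fixes the generators is the identity. -/
theorem freeOperad_hom_eq_id (h : (freeOperad ρ).Hom (freeOperad ρ))
    (hg : ∀ e, h.app (Fin 2) (freeGen ρ e) = freeGen ρ e) (A : Type) [Finite A]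
    (p : (freeOperad ρ).obj A) : h.app A p = p := by
  -- Classes of formal composites span the free operad, so structural induction on composites
  -- suffices.
  have key : ∀ {A : Type} [Finite A] (s : Term E A), h.app A (freeMk ρ s) = freeMk ρ s := by
    intro A _ s
    induction s with
    | one => exact h.app_one
    | gen e => exact hg e
    | map σ s ih => rw [← freeOperad_map_freeMk, h.app_map, ih]
    | comp a s t ihs iht => rw [← freeOperad_comp_freeMk, h.app_comp, ihs, iht]
  have e : h.app A = LinearMap.id := freeOperad_linearMap_ext key
  rw [e, LinearMap.id_apply]

end FreeLift

/-! ### A model: linear combinations of functions of several variables -/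

section EndOperad

variable (K : Type u) [Field K] (X : Type)

open Classical in
/-- Substitution of a function of several variables for one variable of another. -/
def substitute {A B : Type} (a : A) (s : (A → X) → X) (t : (B → X) → X) :
    ({x : A // x ≠ a} ⊕ B → X) → X :=
  fun v => s fun x => if h : x = a then t (fun b => v (Sum.inr b)) else v (Sum.inl ⟨x, h⟩)

/-- Renaming of variables. -/
def rename {A B : Type} (σ : A ≃ B) (s : (A → X) → X) : (B → X) → X :=
  fun v => s fun x => v (σ x)

/-- Linear combinations of functions of several variables on a set. -/
def endData : OperadData.{u, u} K where
  obj A _ := ((A → X) → X) →₀ K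
  map σ := Finsupp.lmapDomain K K (rename X σ)
  one := Finsupp.single (fun v => v ()) 1
  comp a := Finsupp.linearCombination K (fun s => Finsupp.lmapDomain K K (substitute X a s))

/-- A function of several variables, as an operation. -/
def endMk {A : Type} [Finite A] (s : (A → X) → X) : (endData K X).obj A :=
  (Finsupp.single s 1 : ((A → X) → X) →₀ K)

variable {X}

theorem endData_hom_ext {A : Type} [Finite A] {M : Type*} [AddCommGroup M] [Module K M]
    {f g : (endData K X).obj A →ₗ[K] M} (h : ∀ s, f (endMk K X s) = g (endMk K X s)) : f = g :=
  Finsupp.lhom_ext' fun s => LinearMap.ext_ring (h s)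

theorem endData_map_endMk {A B : Type} [Finite A] [Finite B] (σ : A ≃ B) (s : (A → X) → X) :
    (endData K X).map σ (endMk K X s) = endMk K X (rename X σ s) :=
  Finsupp.mapDomain_single

theorem endData_comp_endMk {A B : Type} [Finite A] [Finite B] (a : A) (s : (A → X) → X)
    (t : (B → X) → X) :
    (endData K X).comp a (endMk K X s) (endMk K X t) = endMk K X (substitute X a s t) := by
  change Finsupp.linearCombination K
    (fun s : (A → X) → X => (Finsupp.lmapDomain K K (substitute X a s) :
      (((B → X) → X) →₀ K) →ₗ[K] (({x : A // x ≠ a} ⊕ B → X) → X) →₀ K)) (Finsupp.single s 1)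
    (Finsupp.single t 1) = Finsupp.single (substitute X a s t) 1
  rw [Finsupp.linearCombination_single, one_smul, Finsupp.lmapDomain_apply,
    Finsupp.mapDomain_single]

/-- The operad axioms are multilinear, so this reduces them to identities between single functions.
-/
theorem endData_induction {A : Type} [Finite A] {motive : (endData K X).obj A → Prop}
    (p : (endData K X).obj A) (zero : motive 0) (add : ∀ p q, motive p → motive q → motive (p + q))
    (smul : ∀ (c : K) p, motive p → motive (c • p)) (mk : ∀ s, motive (endMk K X s)) :
    motive p := by
  refine Finsupp.induction_linear (motive := motive) p zero add fun s c => ?_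
  have h := smul c _ (mk s)
  have e : c • endMk K X s = (Finsupp.single s c : ((A → X) → X) →₀ K) :=
    (Finsupp.smul_single c s (1 : K)).trans (by rw [smul_eq_mul, mul_one])
  rwa [e] at h

/-- Both sides apply `s`; its arguments are compared one variable at a time, according to whether
the variable is the substituted one. The four identities that follow are of the same kind. -/
theorem rename_substitute {A A' B B' : Type} (σ : A ≃ A') (τ : B ≃ B') (a : A) (s : (A → X) → X)
    (t : (B → X) → X) :
    substitute X (σ a) (rename X σ s) (rename X τ t) =
      rename X (compEquiv σ τ a) (substitute X a s t) := by
  funext v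
  refine congrArg s (funext fun x => ?_)
  by_cases h : x = a
  · subst h
    simp [rename, compEquiv]
  · simp [h, compEquiv]

theorem rename_substitute_one_left {B : Type} (t : (B → X) → X) :
    rename X (leftUnitEquiv B) (substitute X () (fun v => v ()) t) = t := by
  funext v
  simp only [rename, substitute, dite_true]
  rfl

theorem rename_substitute_one_right {A : Type} (a : A) (s : (A → X) → X) :
    rename X (rightUnitEquiv a) (substitute X a s (fun v => v ())) = s := by
  funext v
  refine congrArg s (funext fun x => ?_)
  by_cases h : x = a
  · subst h
    simp only [dite_true]
    rfl
  · simp only [h, dite_false]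
    rfl

theorem rename_substitute_seq {A B C : Type} (a : A) (b : B) (s : (A → X) → X) (t : (B → X) → X)
    (r : (C → X) → X) :
    rename X (seqEquiv C a b) (substitute X a s (substitute X b t r)) =
      substitute X (Sum.inr b) (substitute X a s t) r := by
  funext v
  refine congrArg s (funext fun x => ?_)
  by_cases h : x = a
  · subst h
    simp only [dite_true]
    refine congrArg t (funext fun y => ?_)
    by_cases h' : y = b
    · subst h'
      simp [seqEquiv]
    · simp [h', seqEquiv]
  · simp [h, seqEquiv]

theorem rename_substitute_par {A B C : Type} (a a' : A) (h : a ≠ a') (s : (A → X) → X)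
    (t : (B → X) → X) (r : (C → X) → X) :
    rename X (parEquiv B C a a' h) (substitute X (Sum.inl ⟨a', h.symm⟩) (substitute X a s t) r) =
      substitute X (Sum.inl ⟨a, h⟩) (substitute X a' s r) t := by
  funext v
  refine congrArg s (funext fun x => ?_)
  by_cases h1 : x = a
  · subst h1
    simp [h, parEquiv]
  · by_cases h2 : x = a'
    · subst h2
      simp [h1, parEquiv]
    · simp [h1, h2, parEquiv]

variable (X)

/-- The operad of linear combinations of functions of several variables on a set. -/
def endOperad : Operad.{u, u} K where
  toOperadData := endData K X
  isOperad :=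
    { map_refl := fun {A} _ p => by
        suffices h : (endData K X).map (Equiv.refl A) = LinearMap.id from LinearMap.congr_fun h p
        exact endData_hom_ext K fun s => endData_map_endMk K _ s
      map_trans := fun σ τ p => by
        suffices h : (endData K X).map (σ.trans τ) = (endData K X).map τ ∘ₗ (endData K X).map σ from
          LinearMap.congr_fun h p
        refine endData_hom_ext K fun s => ?_
        simp only [LinearMap.comp_apply, endData_map_endMk]
        rfl
      comp_map := fun σ τ a p q => by
        induction p using endData_induction with
        | zero => simp only [map_zero, LinearMap.zero_apply]
        | add p p' h h' => simp only [map_add, LinearMap.add_apply, h, h']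
        | smul c p h => simp only [map_smul, LinearMap.smul_apply, h]
        | mk s =>
          induction q using endData_induction with
          | zero => simp only [map_zero]
          | add p p' h h' => simp only [map_add, h, h']
          | smul c p h => simp only [map_smul, h]
          | mk t => simp only [endData_map_endMk, endData_comp_endMk, rename_substitute]
      one_comp := fun {B} _ q => by
        have e : (endData K X).one = endMk K X (fun v => v ()) := rfl
        induction q using endData_induction with
        | zero => simp only [map_zero]
        | add p p' h h' => simp only [map_add, h, h']
        | smul c p h => simp only [map_smul, h]
        | mk t =>
          rw [e, endData_comp_endMk, endData_map_endMk, rename_substitute_one_left]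
      comp_one := fun a p => by
        have e : (endData K X).one = endMk K X (fun v => v ()) := rfl
        induction p using endData_induction with
        | zero => simp only [map_zero, LinearMap.zero_apply]
        | add p p' h h' => simp only [map_add, LinearMap.add_apply, h, h']
        | smul c p h => simp only [map_smul, LinearMap.smul_apply, h]
        | mk t =>
          rw [e, endData_comp_endMk, endData_map_endMk, rename_substitute_one_right]
      assoc_seq := fun a b p q r => by
        induction p using endData_induction with
        | zero => simp only [map_zero, LinearMap.zero_apply]
        | add p p' h h' => simp only [map_add, LinearMap.add_apply, h, h']
        | smul c p h => simp only [map_smul, LinearMap.smul_apply, h]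
        | mk s =>
          induction q using endData_induction with
          | zero => simp only [map_zero, LinearMap.zero_apply]
          | add p p' h h' => simp only [map_add, LinearMap.add_apply, h, h']
          | smul c p h => simp only [map_smul, LinearMap.smul_apply, h]
          | mk t =>
            induction r using endData_induction with
            | zero => simp only [map_zero]
            | add p p' h h' => simp only [map_add, h, h']
            | smul c p h => simp only [map_smul, h]
            | mk r => simp only [endData_map_endMk, endData_comp_endMk, rename_substitute_seq]
      assoc_par := fun a a' hne p q r => by
        induction p using endData_induction with
        | zero => simp only [map_zero, LinearMap.zero_apply]
        | add p p' h h' => simp only [map_add, LinearMap.add_apply, h, h']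
        | smul c p h => simp only [map_smul, LinearMap.smul_apply, h]
        | mk s =>
          induction q using endData_induction with
          | zero => simp only [map_zero, LinearMap.zero_apply]
          | add p p' h h' => simp only [map_add, LinearMap.add_apply, h, h']
          | smul c p h => simp only [map_smul, LinearMap.smul_apply, h]
          | mk t =>
            induction r using endData_induction with
            | zero => simp only [map_zero, LinearMap.zero_apply]
            | add p p' h h' => simp only [map_add, LinearMap.add_apply, h, h']
            | smul c p h => simp only [map_smul, LinearMap.smul_apply, h]
            | mk r => simp only [endData_map_endMk, endData_comp_endMk, rename_substitute_par] }

/-- Operations are formal combinations of functions, so distinct functions are independent by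
construction. This is what makes the model useful. -/
theorem linearIndependent_endMk (A : Type) [Finite A] :
    LinearIndependent K (fun s : (A → X) → X => endMk K X s) :=
  (Finsupp.basisSingleOne (ι := (A → X) → X) (R := K)).linearIndependent

end EndOperad

/-! ### The standard basis of the free `S_2`-module -/

section GenBasis

variable (K : Type u) [Field K]

/-- The basis of the free `S_2`-module on `m` and `↘` formed by the elements `σ · g`. -/
def genBasis : Module.Basis (Gen × Equiv.Perm (Fin 2)) K
    (Gen →₀ MonoidAlgebra K (Equiv.Perm (Fin 2))) :=
  Module.Basis.ofRepr ((Finsupp.mapRange.linearEquiv (MonoidAlgebra.coeffLinearEquiv K)).trans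
    (Finsupp.curryLinearEquiv K).symm)

theorem genBasis_apply (g : Gen) (σ : Equiv.Perm (Fin 2)) :
    genBasis K (g, σ) = Finsupp.single g (MonoidAlgebra.single σ 1) := by
  refine (genBasis K).repr.injective ?_
  rw [Module.Basis.repr_self]
  change _ = Finsupp.uncurry (Finsupp.mapRange (MonoidAlgebra.coeffLinearEquiv K) (map_zero _)
    (Finsupp.single g (MonoidAlgebra.single σ 1)))
  rw [Finsupp.mapRange_single]
  exact (Finsupp.uncurry_single _ _ _).symm

theorem genBasis_one (g : Gen) : genBasis K (g, 1) = genElt K g :=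
  genBasis_apply K g 1

theorem genRep_genBasis (τ σ : Equiv.Perm (Fin 2)) (g : Gen) :
    genRep K τ (genBasis K (g, σ)) = genBasis K (g, τ * σ) := by
  rw [genBasis_apply, genBasis_apply, genRep, Representation.free_single_single]

theorem genDual_eq_coord (g : Gen) : genDual K g = (genBasis K).coord (g, 1) :=
  rfl

end GenBasis

/-! ### Linear independence of the tree operations -/

instance : DecidableEq Gen := Classical.decEq _

instance : Fintype Gen where
  elems := {Gen.m, Gen.se}
  complete g := by cases g <;> simp

theorem Gen.sum_eq {M : Type*} [AddCommMonoid M] (f : Gen → M) :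
    ∑ g, f g = f Gen.m + f Gen.se :=
  Finset.sum_pair (by simp)

/-- Bracketed words in three letters for two binary operations. -/
inductive Magma
  | leaf (i : Fin 3)
  | node (g : Gen) (s t : Magma)

/-- The index `(π, b, g, h)` stands for the operation `π · (g ∘ (h, I))` if `b` is `false`, and for
`π · (g ∘ (I, h))` if `b` is `true`. -/
abbrev TreeIndex : Type := (Equiv.Perm (Fin 3) × Bool) × Gen × Gen

section TreeOp

/-- `p ∘ (q, I)` or `p ∘ (I, q)`. -/
def Operad.sideComp {K : Type u} [Field K] (P : Operad.{u, v} K) :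
    Bool → P.obj (Fin 2) →ₗ[K] P.obj (Fin 2) →ₗ[K] P.obj (Fin 3)
  | false => P.compLeft
  | true => P.compRight

theorem Operad.Hom.app_sideComp {K : Type u} [Field K] {P : Operad.{u, v} K}
    {Q : Operad.{u, w} K} (f : P.Hom Q) (b : Bool) (p q : P.obj (Fin 2)) :
    f.app (Fin 3) (P.sideComp b p q) =
      Q.sideComp b (f.app (Fin 2) p) (f.app (Fin 2) q) := by
  cases b
  · exact (f.app_map _ _).trans (congrArg _ (f.app_comp _ _ _))
  · exact (f.app_map _ _).trans (congrArg _ (f.app_comp _ _ _))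

variable (K : Type u) [Field K]

/-- The operation of the free operad of a given index. -/
def treeOp (x : TreeIndex) : (freeOperad (genRep K)).obj (Fin 3) :=
  (freeOperad (genRep K)).map x.1.1
    ((freeOperad (genRep K)).sideComp x.1.2 (freeOp K x.2.1) (freeOp K x.2.2))

/-- The operation of a given index on bracketed words. -/
def treeFun (x : TreeIndex) (v : Fin 3 → Magma) : Magma :=
  bif x.1.2 then .node x.2.1 (v (x.1.1 0)) (.node x.2.2 (v (x.1.1 1)) (v (x.1.1 2)))
  else .node x.2.1 (.node x.2.2 (v (x.1.1 0)) (v (x.1.1 1))) (v (x.1.1 2))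

/-- Evaluated at three distinct letters, the function returns the tree itself: the bracketing gives
`b`, the nodes give `g` and `h`, and the order of the letters gives `π`. -/
theorem treeFun_injective : Function.Injective treeFun := by
  rintro ⟨⟨π, b⟩, g, h⟩ ⟨⟨π', b'⟩, g', h'⟩ e
  have e' := congrFun e Magma.leaf
  have hπ : π 0 = π' 0 → π 1 = π' 1 → π 2 = π' 2 → π = π' := fun h0 h1 h2 =>
    Equiv.ext fun i => by fin_cases i <;> assumption
  cases b <;> cases b' <;> simp [treeFun] at e'
  · rw [hπ e'.2.1.2.1 e'.2.1.2.2 e'.2.2, e'.1, e'.2.1.1]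
  · rw [hπ e'.2.1 e'.2.2.2.1 e'.2.2.2.2, e'.1, e'.2.2.1]

/-- The generators as operations on bracketed words. -/
def magmaOp (g : Gen) : (endOperad K Magma).obj (Fin 2) :=
  endMk K Magma fun v => .node g (v 0) (v 1)

/-- The action of the generators of the free operad on bracketed words. -/
def magmaGen : (Gen →₀ MonoidAlgebra K (Equiv.Perm (Fin 2))) →ₗ[K]
    (endOperad K Magma).obj (Fin 2) :=
  (genBasis K).constr K fun i => (endOperad K Magma).map i.2 (magmaOp K i.1)

theorem magmaGen_genRep (σ : Equiv.Perm (Fin 2))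
    (e : Gen →₀ MonoidAlgebra K (Equiv.Perm (Fin 2))) :
    magmaGen K (genRep K σ e) = (endOperad K Magma).map σ (magmaGen K e) := by
  suffices h : magmaGen K ∘ₗ genRep K σ = (endOperad K Magma).map σ ∘ₗ magmaGen K from
    LinearMap.congr_fun h e
  refine (genBasis K).ext fun i => ?_
  rw [LinearMap.comp_apply, LinearMap.comp_apply, ← Prod.mk.eta (p := i), genRep_genBasis,
    magmaGen, Module.Basis.constr_basis, Module.Basis.constr_basis,
    ← (endOperad K Magma).isOperad.map_trans]
  rfl

/-- The action of the free operad on bracketed words. -/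
def magmaHom : (freeOperad (genRep K)).Hom (endOperad K Magma) :=
  freeLift (endOperad K Magma) (magmaGen K) (magmaGen_genRep K)

theorem magmaHom_freeOp (g : Gen) : (magmaHom K).app (Fin 2) (freeOp K g) = magmaOp K g := by
  refine (freeLift_freeGen _ _ _ _).trans ?_
  rw [← genBasis_one, magmaGen, Module.Basis.constr_basis]
  exact (endOperad K Magma).isOperad.map_refl _

theorem sideComp_magmaOp (b : Bool) (g h : Gen) :
    (endOperad K Magma).sideComp b (magmaOp K g) (magmaOp K h) =
      endMk K Magma (treeFun ((1, b), g, h)) := by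
  cases b
  · refine (congrArg _ (endData_comp_endMk K _ _ _)).trans
      ((endData_map_endMk K _ _).trans (congrArg (endMk K Magma) (funext fun v => ?_)))
    simp only [rename, substitute, treeFun, cond_false, dite_true]
    rw [dif_neg (by decide)]
    rfl
  · refine (congrArg _ (endData_comp_endMk K _ _ _)).trans
      ((endData_map_endMk K _ _).trans (congrArg (endMk K Magma) (funext fun v => ?_)))
    simp only [rename, substitute, treeFun, cond_true, dite_true]
    rw [dif_neg (by decide)]
    rfl

theorem magmaHom_treeOp (x : TreeIndex) :
    (magmaHom K).app (Fin 3) (treeOp K x) = endMk K Magma (treeFun x) := by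
  obtain ⟨⟨π, b⟩, g, h⟩ := x
  rw [treeOp, Operad.Hom.app_map, Operad.Hom.app_sideComp, magmaHom_freeOp, magmaHom_freeOp,
    sideComp_magmaOp]
  refine (endData_map_endMk K _ _).trans (congrArg (endMk K Magma) (funext fun v => ?_))
  cases b <;> rfl

/-- The images under `magmaHom` are pairwise distinct functions, hence independent. -/
theorem linearIndependent_treeOp : LinearIndependent K (treeOp K) := by
  refine LinearIndependent.of_comp ((magmaHom K).app (Fin 3)) ?_
  have e : (magmaHom K).app (Fin 3) ∘ treeOp K = (fun s => endMk K Magma s) ∘ treeFun :=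
    funext (magmaHom_treeOp K)
  rw [e]
  exact (linearIndependent_endMk K Magma (Fin 3)).comp _ treeFun_injective

end TreeOp

/-! ### Comparison of `(E ⊗ E)³` with the tree operations -/

section TreeVec

/-- The action of `S_2` on the first two of three inputs. -/
def extendPerm (σ : Equiv.Perm (Fin 2)) : Equiv.Perm (Fin 3) :=
  if σ = 1 then 1 else Equiv.swap 0 1

theorem perm_two (σ : Equiv.Perm (Fin 2)) : σ = 1 ∨ σ = Equiv.swap 0 1 := by
  revert σ
  decide

theorem Operad.compLeft_map_right {K : Type u} [Field K] (P : Operad.{u, v} K)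
    (σ : Equiv.Perm (Fin 2)) (p q : P.obj (Fin 2)) :
    P.compLeft p (P.map σ q) = P.map (extendPerm σ) (P.compLeft p q) := by
  have h := P.isOperad.comp_map (Equiv.refl (Fin 2)) σ 0 p q
  rw [P.isOperad.map_refl] at h
  refine (congrArg (P.map leftEquiv) h).trans ?_
  refine (P.isOperad.map_trans _ _ _).symm.trans (Eq.trans ?_ (P.isOperad.map_trans _ _ _))
  refine congrArg (fun τ => P.map τ _) (Equiv.ext ?_)
  -- What remains is an equality of two explicit relabellings of at most three inputs.
  obtain rfl | rfl := perm_two σ <;> decide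

/-- Exchanging the inputs of the outer operation turns the left tree into `p(x₃, q(x₁, x₂))`, a
right tree with rotated inputs. So right trees come from tensors whose outer factor is swapped. -/
theorem Operad.compLeft_map_swap {K : Type u} [Field K] (P : Operad.{u, v} K)
    (p q : P.obj (Fin 2)) :
    P.compLeft (P.map (Equiv.swap 0 1) p) q = P.map (finRotate 3)⁻¹ (P.compRight p q) := by
  have h := P.isOperad.comp_map (Equiv.swap (0 : Fin 2) 1) (Equiv.refl (Fin 2)) 1 p q
  rw [P.isOperad.map_refl] at h
  refine (congrArg (P.map leftEquiv) h).trans ?_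
  refine (P.isOperad.map_trans _ _ _).symm.trans (Eq.trans ?_ (P.isOperad.map_trans _ _ _))
  refine congrArg (fun τ => P.map τ _) (Equiv.ext ?_)
  decide

/-- The summand `u` and the elements `σ`, `τ` of `S_2` with `σ · g ⊗ τ · h` in the summand `u`
representing the operation of index `(π, b, g, h)`. -/
def treeEquiv : Fin 3 × Equiv.Perm (Fin 2) × Equiv.Perm (Fin 2) ≃ Equiv.Perm (Fin 3) × Bool :=
  Equiv.ofBijective (fun y => (finRotate 3 ^ (y.1 : ℕ) * extendPerm y.2.2 *
    (if y.2.1 = 1 then 1 else (finRotate 3)⁻¹), decide (y.2.1 ≠ 1))) (by decide)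

/-- Rotations of three inputs are even, so `π` has the sign of the inner permutation; the outer
permutation is odd exactly for right trees. -/
theorem sign_treeEquiv (y : Fin 3 × Equiv.Perm (Fin 2) × Equiv.Perm (Fin 2)) :
    Equiv.Perm.sign y.2.1 * Equiv.Perm.sign y.2.2 =
      Equiv.Perm.sign (treeEquiv y).1 * (bif (treeEquiv y).2 then -1 else 1) := by
  revert y
  decide

variable (K : Type u) [Field K]

theorem treeMap_single {E : Type v} [AddCommGroup E] [Module K E]
    (ρ : Representation K (Equiv.Perm (Fin 2)) E) (u : Fin 3) (e f : E) :
    treeMap ρ (Pi.single u (e ⊗ₜ f)) = (freeOperad ρ).map (finRotate 3 ^ (u : ℕ))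
      ((freeOperad ρ).compLeft (freeGen ρ e) (freeGen ρ f)) := by
  rw [treeMap, LinearMap.sum_apply, Finset.sum_eq_single u]
  · simp
  · intro u' _ h
    simp [h]
  · simp

theorem treeMap_single_genBasis (y : Fin 3 × Equiv.Perm (Fin 2) × Equiv.Perm (Fin 2)) (g h : Gen) :
    treeMap (genRep K) (Pi.single y.1 (genBasis K (g, y.2.1) ⊗ₜ genBasis K (h, y.2.2))) =
      treeOp K (treeEquiv y, g, h) := by
  have hb : ∀ (σ : Equiv.Perm (Fin 2)) (g : Gen), freeGen (genRep K) (genBasis K (g, σ)) =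
      (freeOperad (genRep K)).map σ (freeOp K g) := fun σ g => by
    rw [freeOp, ← freeGen_rep, ← genBasis_one, genRep_genBasis, mul_one]
  obtain ⟨u, σ, τ⟩ := y
  rw [treeMap_single, hb, hb, Operad.compLeft_map_right]
  obtain rfl | rfl := perm_two σ
  · have h1 : (freeOperad (genRep K)).map (1 : Equiv.Perm (Fin 2)) (freeOp K g) = freeOp K g :=
      (freeOperad (genRep K)).isOperad.map_refl _
    rw [h1, ← Operad.isOperad _ |>.map_trans]
    rfl
  · rw [Operad.compLeft_map_swap, ← Operad.isOperad _ |>.map_trans,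
      ← Operad.isOperad _ |>.map_trans]
    rfl

/-- The space `(E ⊗ E)³`. -/
abbrev TreeSpace (K : Type u) [Field K] (E : Type v) [AddCommGroup E] [Module K E] : Type _ :=
  Fin 3 → E ⊗[K] E

/-- The element of `(E ⊗ E)³` which represents the operation of a given index. -/
def treeVec (x : TreeIndex) : TreeSpace K (Gen →₀ MonoidAlgebra K (Equiv.Perm (Fin 2))) :=
  Pi.single (treeEquiv.symm x.1).1 (genBasis K (x.2.1, (treeEquiv.symm x.1).2.1) ⊗ₜ
    genBasis K (x.2.2, (treeEquiv.symm x.1).2.2))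

theorem treeMap_treeVec (x : TreeIndex) : treeMap (genRep K) (treeVec K x) = treeOp K x := by
  rw [treeVec, treeMap_single_genBasis, Equiv.apply_symm_apply]

theorem span_treeVec : ⊤ ≤ Submodule.span K (Set.range (treeVec K)) := by
  rw [← (Pi.basis fun _ : Fin 3 => (genBasis K).tensorProduct (genBasis K)).span_eq]
  refine Submodule.span_mono ?_
  rintro _ ⟨⟨u, ⟨g, σ⟩, ⟨h, τ⟩⟩, rfl⟩
  refine ⟨(treeEquiv (u, σ, τ), g, h), ?_⟩
  rw [treeVec, Equiv.symm_apply_apply, Pi.basis_apply, Module.Basis.tensorProduct_apply]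

/-- The basis of `(E ⊗ E)³` which represents the operations `π · (g ∘ (h, I))` and
`π · (g ∘ (I, h))`. -/
def treeBasis : Module.Basis TreeIndex K
    (TreeSpace K (Gen →₀ MonoidAlgebra K (Equiv.Perm (Fin 2)))) :=
  Module.Basis.mk (v := treeVec K) (LinearIndependent.of_comp (treeMap (genRep K)) (by
    have e : treeMap (genRep K) ∘ treeVec K = treeOp K := funext (treeMap_treeVec K)
    rw [e]
    exact linearIndependent_treeOp K)) (span_treeVec K)

theorem treeBasis_apply (x : TreeIndex) : treeBasis K x = treeVec K x :=
  Module.Basis.mk_apply _ _ x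

/-- A basis goes to an independent family. Injectivity ensures that the preimage of `R` contains
nothing beyond the relations. -/
theorem treeMap_injective : Function.Injective (treeMap (genRep K)) := by
  have e : treeMap (genRep K) = (treeBasis K).constr K (treeOp K) :=
    (treeBasis K).ext fun x => by
      rw [Module.Basis.constr_basis, treeBasis_apply, treeMap_treeVec]
  rw [e]
  exact (treeBasis K).injective_constr_of_linearIndependent (linearIndependent_treeOp K)

end TreeVec

/-! ### Functoriality of the free operad and the pairing on pure tensors -/

section FreeMap

variable {K : Type u} [Field K] {E : Type v} [AddCommGroup E] [Module K E]
  {E' : Type w} [AddCommGroup E'] [Module K E']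
  {ρ : Representation K (Equiv.Perm (Fin 2)) E} {ρ' : Representation K (Equiv.Perm (Fin 2)) E'}

/-- The morphism of free operads induced by an equivariant map. -/
def freeMap (φ : E →ₗ[K] E') (h : ∀ σ e, φ (ρ σ e) = ρ' σ (φ e)) :
    (freeOperad ρ).Hom (freeOperad ρ') :=
  freeLift (freeOperad ρ') (freeGen ρ' ∘ₗ φ) fun σ e => by
    rw [LinearMap.comp_apply, LinearMap.comp_apply, h, freeGen_rep]

theorem freeMap_freeGen (φ : E →ₗ[K] E') (h : ∀ σ e, φ (ρ σ e) = ρ' σ (φ e)) (e : E) :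
    (freeMap φ h).app (Fin 2) (freeGen ρ e) = freeGen ρ' (φ e) :=
  freeLift_freeGen _ _ _ e

/-- Naturality of the tree identification; it carries the orthogonal from `F(E^∨)(3)` back to
`F(E)(3)`. -/
theorem freeMap_treeMap (φ : E ≃ₗ[K] E') (h : ∀ σ e, φ (ρ σ e) = ρ' σ (φ e))
    (w : Fin 3 → E ⊗[K] E) :
    (freeMap φ.toLinearMap h).app (Fin 3) (treeMap ρ w) =
      treeMap ρ' (LinearEquiv.piCongrRight (fun _ => TensorProduct.congr φ φ) w) := by
  suffices e : (freeMap φ.toLinearMap h).app (Fin 3) ∘ₗ treeMap ρ = treeMap ρ' ∘ₗ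
      (LinearEquiv.piCongrRight (fun _ : Fin 3 => TensorProduct.congr φ φ)).toLinearMap from
    LinearMap.congr_fun e w
  refine LinearMap.pi_ext' fun u => TensorProduct.ext' fun e f => ?_
  have e1 : LinearEquiv.piCongrRight (fun _ : Fin 3 => TensorProduct.congr φ φ)
      (Pi.single u (e ⊗ₜ f)) = Pi.single u (φ e ⊗ₜ φ f) := by
    ext1 u'
    obtain rfl | hu := eq_or_ne u' u
    · simp
    · simp [hu]
  simp only [LinearMap.comp_apply, LinearMap.single_apply, LinearEquiv.coe_coe, e1,
    treeMap_single, Operad.Hom.app_map]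
  refine congrArg _ (((freeMap φ.toLinearMap h).app_sideComp false _ _).trans ?_)
  rw [freeMap_freeGen, freeMap_freeGen]
  rfl

theorem treePairing_single (u u' : Fin 3) (α β : Module.Dual K E) (e f : E) :
    treePairing K E (Pi.single u (α ⊗ₜ β)) (Pi.single u' (e ⊗ₜ f)) =
      if u = u' then α e * β f else 0 := by
  rw [treePairing, LinearMap.sum_apply, LinearMap.sum_apply, Finset.sum_eq_single u]
  · obtain rfl | hu := eq_or_ne u u'
    · simp [Module.Dual.transpose]
    · simp [Module.Dual.transpose, hu]
  · intro v _ h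
    simp [h]
  · simp

end FreeMap

/-! ### The self-duality of `E` and the diagonal form of the pairing -/

section SelfDual

variable (K : Type u) [Field K]

/-- The isomorphism of `E` with `E^∨` which sends `σ · g` to `sgn(σ) (σ · g)^*`. -/
def genSelfDual : (Gen →₀ MonoidAlgebra K (Equiv.Perm (Fin 2))) ≃ₗ[K]
    Module.Dual K (Gen →₀ MonoidAlgebra K (Equiv.Perm (Fin 2))) :=
  (genBasis K).equiv ((genBasis K).dualBasis.unitsSMul fun i =>
    Units.map (Int.castRingHom K : ℤ →* K) (Equiv.Perm.sign i.2)) (Equiv.refl _)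

theorem genSelfDual_genBasis (i : Gen × Equiv.Perm (Fin 2)) :
    genSelfDual K (genBasis K i) =
      ((Equiv.Perm.sign i.2 : ℤ) : K) • (genBasis K).coord i := by
  rw [genSelfDual, Module.Basis.equiv_apply, Module.Basis.unitsSMul_apply,
    Module.Basis.coe_dualBasis]
  rfl

theorem genSelfDual_genElt (g : Gen) : genSelfDual K (genElt K g) = genDual K g := by
  rw [← genBasis_one, genSelfDual_genBasis, genDual_eq_coord]
  simp

theorem genSelfDual_apply (i j : Gen × Equiv.Perm (Fin 2)) :
    genSelfDual K (genBasis K i) (genBasis K j) =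
      if i = j then ((Equiv.Perm.sign i.2 : ℤ) : K) else 0 := by
  rw [genSelfDual_genBasis, LinearMap.smul_apply, Module.Basis.coord_apply,
    Module.Basis.repr_self, Finsupp.single_apply, smul_eq_mul, mul_ite, mul_one, mul_zero]
  simp only [eq_comm]

/-- In `E^∨`, `σ` sends `(τ · g)^*` to `sgn(σ) (στ · g)^*`, and `sgn(σ) sgn(τ) = sgn(στ)`. -/
theorem genSelfDual_genRep (σ : Equiv.Perm (Fin 2))
    (e : Gen →₀ MonoidAlgebra K (Equiv.Perm (Fin 2))) :
    genSelfDual K (genRep K σ e) = signDual (genRep K) σ (genSelfDual K e) := by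
  suffices h : (genSelfDual K).toLinearMap ∘ₗ genRep K σ =
      signDual (genRep K) σ ∘ₗ (genSelfDual K).toLinearMap from LinearMap.congr_fun h e
  refine (genBasis K).ext fun ⟨g, τ⟩ => (genBasis K).ext fun ⟨h, τ'⟩ => ?_
  have e1 : (signDual (genRep K) σ ∘ₗ (genSelfDual K).toLinearMap) (genBasis K (g, τ))
      (genBasis K (h, τ')) = ((Equiv.Perm.sign σ : ℤ) : K) *
        genSelfDual K (genBasis K (g, τ)) (genRep K σ⁻¹ (genBasis K (h, τ'))) := rfl
  rw [e1, LinearMap.comp_apply, genRep_genBasis, genRep_genBasis, LinearEquiv.coe_coe,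
    genSelfDual_apply, genSelfDual_apply]
  simp only [Prod.mk.injEq, eq_inv_mul_iff_mul_eq, map_mul, Units.val_mul, Int.cast_mul, mul_ite,
    mul_zero]

theorem signDual_genSelfDual_symm (σ : Equiv.Perm (Fin 2))
    (f : Module.Dual K (Gen →₀ MonoidAlgebra K (Equiv.Perm (Fin 2)))) :
    (genSelfDual K).symm (signDual (genRep K) σ f) = genRep K σ ((genSelfDual K).symm f) := by
  rw [LinearEquiv.symm_apply_eq, genSelfDual_genRep, LinearEquiv.apply_symm_apply]

/-- The isomorphism of `(E ⊗ E)³` with `(E^∨ ⊗ E^∨)³`. -/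
def treeSelfDual : TreeSpace K (Gen →₀ MonoidAlgebra K (Equiv.Perm (Fin 2))) ≃ₗ[K]
    (Fin 3 → Module.Dual K (Gen →₀ MonoidAlgebra K (Equiv.Perm (Fin 2))) ⊗[K]
      Module.Dual K (Gen →₀ MonoidAlgebra K (Equiv.Perm (Fin 2)))) :=
  LinearEquiv.piCongrRight fun _ => TensorProduct.congr (genSelfDual K) (genSelfDual K)

/-- The square of the basis element of a given index for the pairing. -/
def treeSign (y : Equiv.Perm (Fin 3) × Bool) : K :=
  ((Equiv.Perm.sign y.1 : ℤ) : K) * bif y.2 then -1 else 1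

theorem treeSign_ne_zero (y : Equiv.Perm (Fin 3) × Bool) : treeSign K y ≠ 0 := by
  obtain ⟨π, b⟩ := y
  obtain h | h := Int.units_eq_one_or (Equiv.Perm.sign π) <;> cases b <;> simp [treeSign, h]

/-- On pure tensors the pairing is a product of two Kronecker symbols, with coefficient `sgn(σ)
sgn(τ)`, which `sign_treeEquiv` rewrites in terms of the tree. -/
theorem treePairing_treeBasis (x y : TreeIndex) :
    treePairing K _ (treeSelfDual K (treeBasis K x)) (treeBasis K y) =
      if x = y then treeSign K x.1 else 0 := by
  have e1 : treeSelfDual K (treeBasis K x) = Pi.single (treeEquiv.symm x.1).1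
      (genSelfDual K (genBasis K (x.2.1, (treeEquiv.symm x.1).2.1)) ⊗ₜ
        genSelfDual K (genBasis K (x.2.2, (treeEquiv.symm x.1).2.2))) := by
    rw [treeBasis_apply]
    ext1 u
    obtain rfl | hu := eq_or_ne u (treeEquiv.symm x.1).1
    · simp [treeSelfDual, treeVec]
    · simp [treeSelfDual, treeVec, hu]
  rw [e1, treeBasis_apply, treeVec, treePairing_single, genSelfDual_apply, genSelfDual_apply]
  have hs := sign_treeEquiv (treeEquiv.symm x.1)
  rw [Equiv.apply_symm_apply] at hs
  obtain ⟨y0, g, h⟩ := x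
  obtain ⟨y0', g', h'⟩ := y
  obtain ⟨z, rfl⟩ := treeEquiv.surjective y0
  obtain ⟨z', rfl⟩ := treeEquiv.surjective y0'
  obtain ⟨u, σ, τ⟩ := z
  obtain ⟨u', σ', τ'⟩ := z'
  simp only [Equiv.symm_apply_apply, Prod.mk.injEq, EmbeddingLike.apply_eq_iff_eq] at hs ⊢
  have hs' : ((Equiv.Perm.sign σ : ℤ) : K) * ((Equiv.Perm.sign τ : ℤ) : K) =
      treeSign K (treeEquiv (u, σ, τ)) := by
    rw [treeSign, ← Int.cast_mul, ← Units.val_mul, hs]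
    cases (treeEquiv (u, σ, τ)).2 <;> simp
  rw [← hs']
  by_cases h1 : u = u' <;> by_cases h2 : g = g' <;> by_cases h3 : σ = σ' <;>
    by_cases h4 : h = h' <;> by_cases h5 : τ = τ' <;> simp [h1, h2, h3, h4, h5]

/-- The pairing reads off coordinates. -/
theorem treePairing_apply_treeBasis
    (w : TreeSpace K (Gen →₀ MonoidAlgebra K (Equiv.Perm (Fin 2)))) (y : TreeIndex) :
    treePairing K _ (treeSelfDual K w) (treeBasis K y) =
      treeSign K y.1 * (treeBasis K).repr w y := by
  suffices h : LinearMap.flip (treePairing K _ ∘ₗ (treeSelfDual K).toLinearMap) (treeBasis K y) =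
      treeSign K y.1 • (treeBasis K).coord y from LinearMap.congr_fun h w
  refine (treeBasis K).ext fun x => ?_
  refine (treePairing_treeBasis K x y).trans ?_
  rw [LinearMap.smul_apply, Module.Basis.coord_apply, Module.Basis.repr_self,
    Finsupp.single_apply, smul_eq_mul]
  split_ifs with h
  · rw [h, mul_one]
  · rw [mul_zero]

end SelfDual

/-! ### Computation of the orthogonal of the relations -/

section Orthogonal

variable (K : Type u) [Field K]

theorem Operad.map_mem_symSpan {K : Type u} [Field K] (P : Operad.{u, v} K)
    {S : Set (P.obj (Fin 3))} (π : Equiv.Perm (Fin 3)) {x : P.obj (Fin 3)} (hx : x ∈ S) :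
    P.map π x ∈ P.symSpan S :=
  Submodule.subset_span ⟨π, x, hx, rfl⟩

theorem map_add_neg_one_smul {K V W : Type*} [Field K] [AddCommMonoid V] [Module K V]
    [AddCommGroup W] [Module K W] (f : V →ₗ[K] W) (a b : V) :
    f (a + (-1 : K) • b) = f a - f b := by
  rw [map_add, map_smul, neg_one_smul, sub_eq_add_neg]

theorem treeMap_treeBasis (x : TreeIndex) :
    treeMap (genRep K) (treeBasis K x) = treeOp K x := by
  rw [treeBasis_apply, treeMap_treeVec]

theorem treeOp_eq (π : Equiv.Perm (Fin 3)) (b : Bool) (g h : Gen) :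
    treeOp K ((π, b), g, h) = (freeOperad (genRep K)).map π
      ((freeOperad (genRep K)).sideComp b (freeOp K g) (freeOp K h)) :=
  rfl

/-- Each relation, relabelled by `π`, is a difference of two basis trees, so vanishing on it means
equal values on these trees. -/
theorem mem_dualAnnihilator_iff
    (l : Module.Dual K (TreeSpace K (Gen →₀ MonoidAlgebra K (Equiv.Perm (Fin 2))))) :
    l ∈ (((freeOperad (genRep K)).symSpan (seRelations K)).comap
        (treeMap (genRep K))).dualAnnihilator ↔
      ∀ π : Equiv.Perm (Fin 3),
        l (treeBasis K ((π, false), Gen.se, Gen.m)) =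
          l (treeBasis K ((π, true), Gen.se, Gen.se)) ∧
        l (treeBasis K ((π, true), Gen.se, Gen.m)) =
          l (treeBasis K ((π, false), Gen.m, Gen.se)) ∧
        l (treeBasis K ((π, false), Gen.m, Gen.m)) =
          l (treeBasis K ((π, true), Gen.m, Gen.m)) := by
  rw [Submodule.mem_dualAnnihilator]
  constructor
  · intro h π
    have key : ∀ x y : TreeIndex, treeOp K x - treeOp K y ∈
        (freeOperad (genRep K)).symSpan (seRelations K) →
        l (treeBasis K x) = l (treeBasis K y) := fun x y hxy => by
      rw [← sub_eq_zero, ← map_sub]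
      refine h _ ?_
      rwa [Submodule.mem_comap, map_sub, treeMap_treeBasis, treeMap_treeBasis]
    refine ⟨key _ _ ?_, key _ _ ?_, key _ _ ?_⟩ <;> rw [treeOp_eq, treeOp_eq, ← map_sub] <;>
      refine Operad.map_mem_symSpan _ π ?_
    · exact Or.inl rfl
    · exact Or.inr (Or.inl rfl)
    · exact Or.inr (Or.inr rfl)
  · intro h w hw
    -- By injectivity of `treeMap`, a vector lying over an element of `R` is in `ker l` as soon as
    -- that element has some preimage there.
    suffices hle : (freeOperad (genRep K)).symSpan (seRelations K) ≤
        (LinearMap.ker l).map (treeMap (genRep K)) by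
      obtain ⟨w', hw', e⟩ := hle hw
      rw [← treeMap_injective K e]
      exact hw'
    have key : ∀ x y : TreeIndex, l (treeBasis K x) = l (treeBasis K y) →
        treeOp K x - treeOp K y ∈ (LinearMap.ker l).map (treeMap (genRep K)) := fun x y hxy =>
      ⟨treeBasis K x + (-1 : K) • treeBasis K y, by
        rw [SetLike.mem_coe, LinearMap.mem_ker, map_add_neg_one_smul, hxy, sub_self],
        by rw [map_add_neg_one_smul, treeMap_treeBasis, treeMap_treeBasis]⟩
    refine Submodule.span_le.2 ?_
    rintro _ ⟨π, _, rfl | rfl | rfl, rfl⟩ <;> rw [map_sub]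
    · exact key ((π, false), Gen.se, Gen.m) ((π, true), Gen.se, Gen.se) (h π).1
    · exact key ((π, true), Gen.se, Gen.m) ((π, false), Gen.m, Gen.se) (h π).2.1
    · exact key ((π, false), Gen.m, Gen.m) ((π, true), Gen.m, Gen.m) (h π).2.2

/-- The preimage of the orthogonal of the relations of `P_↘`, in coordinates. -/
theorem mem_orthogonal_iff (w : TreeSpace K (Gen →₀ MonoidAlgebra K (Equiv.Perm (Fin 2)))) :
    treePairing K _ (treeSelfDual K w) ∈
      (((freeOperad (genRep K)).symSpan (seRelations K)).comap
        (treeMap (genRep K))).dualAnnihilator ↔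
      ∀ π : Equiv.Perm (Fin 3),
        (treeBasis K).repr w ((π, true), Gen.se, Gen.se) =
          -(treeBasis K).repr w ((π, false), Gen.se, Gen.m) ∧
        (treeBasis K).repr w ((π, true), Gen.se, Gen.m) =
          -(treeBasis K).repr w ((π, false), Gen.m, Gen.se) ∧
        (treeBasis K).repr w ((π, true), Gen.m, Gen.m) =
          -(treeBasis K).repr w ((π, false), Gen.m, Gen.m) := by
  -- Every relation pairs a left tree with a right tree for the same `π`; the opposite signs turn
  -- equal values into opposite coordinates.
  have hs : ∀ π : Equiv.Perm (Fin 3), treeSign K (π, true) = -treeSign K (π, false) := fun π => by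
    simp [treeSign]
  have e1 : ∀ (π : Equiv.Perm (Fin 3)) (a b : K),
      treeSign K (π, false) * a = treeSign K (π, true) * b ↔ b = -a := fun π a b => by
    rw [hs, neg_mul, ← mul_neg, mul_right_inj' (treeSign_ne_zero K _), eq_comm, neg_eq_iff_eq_neg]
  have e2 : ∀ (π : Equiv.Perm (Fin 3)) (a b : K),
      treeSign K (π, true) * b = treeSign K (π, false) * a ↔ b = -a := fun π a b => by
    rw [← e1 π, eq_comm]
  rw [mem_dualAnnihilator_iff]
  simp only [treePairing_apply_treeBasis, e1, e2]

/-- For each `π`, three of the eight coordinates are determined by the others; the five free ones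
are the coefficients of the five relations. -/
theorem treeMap_mem_symSpan (w : TreeSpace K (Gen →₀ MonoidAlgebra K (Equiv.Perm (Fin 2))))
    (hw : treePairing K _ (treeSelfDual K w) ∈
      (((freeOperad (genRep K)).symSpan (seRelations K)).comap
        (treeMap (genRep K))).dualAnnihilator) :
    treeMap (genRep K) w ∈ (freeOperad (genRep K)).symSpan (seDualRelations K) := by
  rw [mem_orthogonal_iff] at hw
  rw [← (treeBasis K).sum_repr w, map_sum, Fintype.sum_prod_type, Fintype.sum_prod_type]
  refine Submodule.sum_mem _ fun π _ => ?_
  obtain ⟨h1, h2, h3⟩ := hw π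
  simp only [Fintype.sum_bool, Fintype.sum_prod_type, Gen.sum_eq, map_smul, treeMap_treeBasis,
    h1, h2, h3, treeOp_eq]
  set c := (treeBasis K).repr w
  set F := freeOperad (genRep K)
  have m1 := F.map_mem_symSpan (S := seDualRelations K) π (Or.inl rfl)
  have m2 := F.map_mem_symSpan (S := seDualRelations K) π (Or.inr (Or.inl rfl))
  have m3 := F.map_mem_symSpan (S := seDualRelations K) π (Or.inr (Or.inr (Or.inl rfl)))
  have m4 := F.map_mem_symSpan (S := seDualRelations K) π (Or.inr (Or.inr (Or.inr (Or.inl rfl))))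
  have m5 := F.map_mem_symSpan (S := seDualRelations K) π (Or.inr (Or.inr (Or.inr (Or.inr rfl))))
  rw [map_sub] at m1 m2 m3
  -- Each difference takes the coordinate of its left tree; each monomial relation takes its own
  -- coordinate.
  convert Submodule.add_mem _ (Submodule.add_mem _ (Submodule.add_mem _ (Submodule.add_mem _
    (Submodule.smul_mem _ (c ((π, false), Gen.se, Gen.m)) m1)
    (Submodule.smul_mem _ (c ((π, false), Gen.m, Gen.m)) m2))
    (Submodule.smul_mem _ (c ((π, false), Gen.m, Gen.se)) m3))
    (Submodule.smul_mem _ (c ((π, false), Gen.se, Gen.se)) m4))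
    (Submodule.smul_mem _ (c ((π, true), Gen.m, Gen.se)) m5) using 1
  simp only [Operad.sideComp]
  module

theorem symSpan_seDualRelations_le : (freeOperad (genRep K)).symSpan (seDualRelations K) ≤
    (((((freeOperad (genRep K)).symSpan (seRelations K)).comap
      (treeMap (genRep K))).dualAnnihilator.comap (treePairing K _)).comap
        (treeSelfDual K).toLinearMap).map (treeMap (genRep K)) := by
  refine Submodule.span_le.2 ?_
  have key1 : ∀ x : TreeIndex, treeOp K x = treeMap (genRep K) (treeBasis K x) := fun x =>
    (treeMap_treeBasis K x).symm
  have key2 : ∀ x y : TreeIndex, treeOp K x - treeOp K y =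
      treeMap (genRep K) (treeBasis K x + (-1 : K) • treeBasis K y) := fun x y => by
    rw [map_add_neg_one_smul, ← key1, ← key1]
  rintro _ ⟨π, _, rfl | rfl | rfl | rfl | rfl, rfl⟩
  · refine ⟨_, (mem_orthogonal_iff K _).2 fun π' => ?_, ((map_sub _ _ _).trans
      (key2 ((π, false), Gen.se, Gen.m) ((π, true), Gen.se, Gen.se))).symm⟩
    simp [Finsupp.single_apply]
  · refine ⟨_, (mem_orthogonal_iff K _).2 fun π' => ?_, ((map_sub _ _ _).trans
      (key2 ((π, false), Gen.m, Gen.m) ((π, true), Gen.m, Gen.m))).symm⟩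
    simp [Finsupp.single_apply]
  · refine ⟨_, (mem_orthogonal_iff K _).2 fun π' => ?_, ((map_sub _ _ _).trans
      (key2 ((π, false), Gen.m, Gen.se) ((π, true), Gen.se, Gen.m))).symm⟩
    simp [Finsupp.single_apply]
  · refine ⟨_, (mem_orthogonal_iff K _).2 fun π' => ?_,
      (key1 ((π, false), Gen.se, Gen.se)).symm⟩
    simp
  · refine ⟨_, (mem_orthogonal_iff K _).2 fun π' => ?_,
      (key1 ((π, true), Gen.m, Gen.se)).symm⟩
    simp

/-- The isomorphism of free operads induced by the isomorphism of `E` with `E^∨`. -/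
def selfDualHom : (freeOperad (genRep K)).Hom (freeOperad (signDual (genRep K))) :=
  freeMap (genSelfDual K).toLinearMap (genSelfDual_genRep K)

/-- The inverse of `selfDualHom`. -/
def selfDualInv : (freeOperad (signDual (genRep K))).Hom (freeOperad (genRep K)) :=
  freeMap (genSelfDual K).symm.toLinearMap (signDual_genSelfDual_symm K)

/-- The composite fixes the generators, hence is the identity. -/
theorem selfDualInv_selfDualHom (A : Type) [Finite A] (p : (freeOperad (genRep K)).obj A) :
    (selfDualInv K).app A ((selfDualHom K).app A p) = p :=
  freeOperad_hom_eq_id ((selfDualHom K).trans (selfDualInv K)) (fun e =>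
    (congrArg ((selfDualInv K).app (Fin 2)) (freeMap_freeGen _ (genSelfDual_genRep K) e)).trans
      ((freeMap_freeGen _ (signDual_genSelfDual_symm K) _).trans
      (congrArg _ ((genSelfDual K).symm_apply_apply e)))) A p

theorem selfDualHom_selfDualInv (A : Type) [Finite A]
    (p : (freeOperad (signDual (genRep K))).obj A) :
    (selfDualHom K).app A ((selfDualInv K).app A p) = p :=
  freeOperad_hom_eq_id ((selfDualInv K).trans (selfDualHom K)) (fun e =>
    (congrArg ((selfDualHom K).app (Fin 2))
      (freeMap_freeGen _ (signDual_genSelfDual_symm K) e)).trans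
      ((freeMap_freeGen _ (genSelfDual_genRep K) _).trans
      (congrArg _ ((genSelfDual K).apply_symm_apply e)))) A p

/-- The orthogonal of the relations of `P_↘` is generated by the five relations. -/
theorem map_symSpan_seDualRelations :
    ((freeOperad (genRep K)).symSpan (seDualRelations K)).map ((selfDualHom K).app (Fin 3)) =
      orthogonal (genRep K) ((freeOperad (genRep K)).symSpan (seRelations K)) := by
  refine le_antisymm ?_ ?_
  · rintro _ ⟨p, hp, rfl⟩
    obtain ⟨w, hw, rfl⟩ := symSpan_seDualRelations_le K hp
    -- The condition on `w` is already the orthogonality of `treeSelfDual K w`.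
    exact ⟨treeSelfDual K w, hw, (freeMap_treeMap (genSelfDual K) _ w).symm⟩
  · rintro _ ⟨w', hw', rfl⟩
    obtain ⟨w, rfl⟩ := (treeSelfDual K).surjective w'
    exact ⟨treeMap (genRep K) w, treeMap_mem_symSpan K w hw',
      freeMap_treeMap (genSelfDual K) _ w⟩

end Orthogonal

/-! ### The isomorphism and the quotient map -/

section Main

variable (K : Type u) [Field K]

/-- The morphism from the operad with the five relations to the Koszul dual of `P_↘`. -/
def presentedToDual : (presentedOperad K (seDualRelations K)).Hom (seKoszulDual K) :=
  (selfDualHom K).quotientMap _ _ (Operad.idealSpan_le _ (fun p hp =>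
    Operad.le_idealSpan _ _ ((map_symSpan_seDualRelations K).le ⟨p, hp, rfl⟩)))

/-- The inverse of `presentedToDual`. -/
def dualToPresented : (seKoszulDual K).Hom (presentedOperad K (seDualRelations K)) :=
  (selfDualInv K).quotientMap _ _ (Operad.idealSpan_le _ (fun p hp => by
    obtain ⟨q, hq, rfl⟩ := (map_symSpan_seDualRelations K).ge hp
    refine Operad.le_idealSpan _ _ ?_
    rwa [selfDualInv_selfDualHom]))

theorem presentedToDual_isIso : (presentedToDual K).IsIso := by
  intro A _
  refine Function.bijective_iff_has_inverse.2 ⟨(dualToPresented K).app A, ?_, ?_⟩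
  · rintro ⟨p⟩
    exact congrArg (Submodule.mkQ _) (selfDualInv_selfDualHom K A p)
  · rintro ⟨p⟩
    exact congrArg (Submodule.mkQ _) (selfDualHom_selfDualInv K A p)

theorem presentedToDual_presentedGen (g : Gen) :
    (presentedToDual K).app (Fin 2) (presentedGen K (seDualRelations K) g) =
      seKoszulDualGen K g :=
  congrArg (Submodule.mkQ _)
    ((freeMap_freeGen _ _ _).trans (congrArg (freeGen _) (genSelfDual_genElt K g)))

/-- The identity morphism of an operad. -/
def Operad.Hom.id (P : Operad.{u, v} K) : P.Hom P where
  app _ _ := LinearMap.id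
  app_map _ _ := rfl
  app_one := rfl
  app_comp _ _ _ := rfl

/-- The three relations are among the five, the second one with the opposite sign. -/
theorem symSpan_seRelations_le : (freeOperad (genRep K)).symSpan (seRelations K) ≤
    (freeOperad (genRep K)).symSpan (seDualRelations K) := by
  refine Submodule.span_le.2 ?_
  rintro _ ⟨π, _, rfl | rfl | rfl, rfl⟩
  · exact Operad.map_mem_symSpan _ π (Or.inl rfl)
  · rw [← neg_sub, map_neg]
    exact Submodule.neg_mem _ (Operad.map_mem_symSpan _ π (Or.inr (Or.inr (Or.inl rfl))))
  · exact Operad.map_mem_symSpan _ π (Or.inr (Or.inl rfl))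

/-- The projection from `P_↘` to the operad with the five relations. -/
def seToPresented : (seOperad K).Hom (presentedOperad K (seDualRelations K)) :=
  (Operad.Hom.id K (freeOperad (genRep K))).quotientMap _ _ (Operad.idealSpan_le _
    ((symSpan_seRelations_le K).trans (Operad.le_idealSpan _ _)))

end Main

end SymOperad

end

/-- The Koszul dual of `P_↘` is the operad generated by `m` and `↘` with the five relations, and
it is a quotient of `P_↘`. -/
theorem mainTheorem5 (K : Type*) [Field K] :
    (∃ f : (SymOperad.presentedOperad K (SymOperad.seDualRelations K)).Hom
        (SymOperad.seKoszulDual K),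
      f.IsIso ∧
        ∀ g : SymOperad.Gen, f.app (Fin 2)
          (SymOperad.presentedGen K (SymOperad.seDualRelations K) g) =
            SymOperad.seKoszulDualGen K g) ∧
    (∃ f : (SymOperad.seOperad K).Hom (SymOperad.seKoszulDual K),
      f.IsQuotient ∧
        ∀ g : SymOperad.Gen, f.app (Fin 2) (SymOperad.seGen K g) =
          SymOperad.seKoszulDualGen K g) := by
  refine ⟨⟨SymOperad.presentedToDual K, SymOperad.presentedToDual_isIso K,
    SymOperad.presentedToDual_presentedGen K⟩,
    (SymOperad.seToPresented K).trans (SymOperad.presentedToDual K), ?_,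
    -- `seToPresented` is induced by the identity of `F(E)` and fixes generators definitionally, so
    -- the same statement serves for both morphisms.
    SymOperad.presentedToDual_presentedGen K⟩
  intro A _
  refine (SymOperad.presentedToDual_isIso K A).2.comp ?_
  rintro ⟨p⟩
  exact ⟨Submodule.mkQ _ p, rfl⟩
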